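/- Let $m\ge 2$ be an integer. Let $p:\mathbb{R}\to[0,\infty)$ be continuous and $2\pi$-periodic with $\int_0^{2\pi}p(x)\,dx=1$ and $$\int_0^{2\pi}\prod_{l=0}^{m-1}p\Big(x+\frac{2\pi l}{m}\Big)\,dx>0,$$ and let $U_1,U_2,\dots$ be independent random points on the unit circle $S^1$ with common density $p$ (as a function of the polar angle, with respect to arc length). Let $g:[0,2\pi]\to\mathbb{R}$ be continuous and strictly concave, three times continuously differentiable in a neighborhood of $\frac{2\pi}{m}$, with $g''\big(\frac{2\pi}{m}\big)\neq 0$. For $u_1,\dots,u_m\in S^1$ let $0=\beta_0\le\beta_1\le\dots\le\beta_{m-1}<2\pi$ be the counterclockwise angles in $[0,2\pi)$ from $u_1$ to $u_1,\dots,u_m$ arranged in nondecreasing order, put $\beta_m=2\pi$, and let $$f(u_1,\dots,u_m)=\sum_{i=1}^m g(\beta_i-\beta_{i-1}).$$ For $n\ge m$ let $H_n=\max_{1\le i_1<\dots<i_m\le n}f(U_{i_1},\dots,U_{i_m})$. Then for every $t>0$ $$\lim_{n\to\infty}\mathbb{P}\Big\{n^{\frac{2m}{m-1}}\Big(m\,g\Big(\frac{2\pi}{m}\Big)-H_n\Big)\le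 t\Big\}=1-\exp\Big(-\frac{t^{\frac{m-1}{2}}K}{m}\Big),$$ where $$K=\frac{(2\pi)^{\frac{m-1}{2}}\displaystyle\int_0^{2\pi}\prod_{l=0}^{m-1}p\Big(x+\frac{2\pi l}{m}\Big)\,dx}{\Big(-g''\big(\frac{2\pi}{m}\big)\Big)^{\frac{m-1}{2}}\,\Gamma\big(\frac{m+1}{2}\big)\,\sqrt{m}}.$$ -/

import Mathlib

open MeasureTheory ProbabilityTheory Filter Topology Real

noncomputable section

/-- The unit circle carries its Borel sigma-algebra. -/
instance circleMeasurableSpace : MeasurableSpace Circle := borel Circle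

instance circleBorelSpace : BorelSpace Circle := ⟨rfl⟩

/-- The central angle from `u` to `v`, taken counterclockwise, as a number in `[0, 2π)`. -/
def centralAngle (u v : Circle) : ℝ :=
  toIcoMod Real.two_pi_pos 0 (Complex.arg ((v / u : Circle) : ℂ))

/-- The central angles `∠ U₁ O U₁ = 0, ∠ U₁ O U₂, …, ∠ U₁ O U_m` of an `m`-tuple of points on the
unit circle, rearranged in nondecreasing order `0 = β₀ ≤ β₁ ≤ … ≤ β_{m-1}`. -/
def sortedAngles {m : ℕ} [NeZero m] (u : Fin m → Circle) : Fin m → ℝ :=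
  let β : Fin m → ℝ := fun j => centralAngle (u 0) (u j)
  β ∘ Tuple.sort β

/-- The lengths `β_{i+1} - β_i` (for `0 ≤ i ≤ m - 1`, with `β_m = 2π`) of the arcs into which the
points of an `m`-tuple divide the unit circle. -/
def arcLength {m : ℕ} [NeZero m] (u : Fin m → Circle) (i : Fin m) : ℝ :=
  (if h : (i : ℕ) + 1 < m then sortedAngles u ⟨i + 1, h⟩ else 2 * π) - sortedAngles u i

/-- The kernel `f(U₁, …, U_m) = ∑_{i=1}^m g(β_i - β_{i-1})`. -/
def arcKernel (g : ℝ → ℝ) {m : ℕ} [NeZero m] (u : Fin m → Circle) : ℝ :=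
  ∑ i : Fin m, g (arcLength u i)

/-- The `U`-max statistic: the maximum of `f (x_{i₁}, …, x_{i_m})` over all
`i₁ < … < i_m` among the first `n` terms of `x` (for `n ≥ m`, this is a maximum over a
nonempty finite set). -/
def uMax {X : Type*} {m : ℕ} (f : (Fin m → X) → ℝ) (x : ℕ → X) (n : ℕ) : ℝ :=
  ⨆ s : Fin m ↪o Fin n, f (fun j => x (s j))

/-- The measure on the unit circle with density `p` (a function of the angle) with respect to
arc length. -/
def circleLaw (p : ℝ → ℝ) : Measure Circle :=
  ((volume.restrict (Set.Ico 0 (2 * π))).withDensity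
    (fun x => ENNReal.ofReal (p x))).map Circle.exp

/-- The constant `K` of the limiting Weibull law. -/
def weibullConst (m : ℕ) (g p : ℝ → ℝ) : ℝ :=
  ((2 * π) ^ (((m : ℝ) - 1) / 2) *
      ∫ x in (0 : ℝ)..(2 * π), ∏ l ∈ Finset.range m, p (x + 2 * π * l / m)) /
    ((-iteratedDeriv 2 g (2 * π / m)) ^ (((m : ℝ) - 1) / 2) *
      Real.Gamma (((m : ℝ) + 1) / 2) * √(m : ℝ))

end

/-! The arcs cut out by an `m`-tuple sum to `2π`, so the deficit `m g(2π/m) - f` equals the sum over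
the arcs of the height of the tangent line of `g` at `2π/m` above its graph: the linear terms cancel
(`sub_sum_sortedGap_eq`). Strict concavity and `g'' ≠ 0` bound each height below by a multiple of
the squared deviation, so a deficit at most `e²` forces every arc to be within `O(e)` of `2π/m`. To
second order the deficit is `-g''/2` times the sum of the squared deviations.

Fix the first point at angle `a` and sort the other `k = m - 1` angles. After rescaling by `e`, the
tuples with deficit at most `e²` converge to an ellipsoid, while the density tends to the product of
the `p(a + 2πl/m)`. Dominated convergence gives probability `~ k! K e^k`
(`tendsto_measureReal_sub_arcKernel_div`). At the scale `e = √t n^(-m/(m-1))` the expected number of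
such tuples among `n` points tends to `t^(k/2) K / m`.

The statistic is within `e²` of its maximum exactly when some tuple has deficit at most `e²`, so it
remains to show that the probability of no such tuple is asymptotically Poisson. The Chen-Stein
bound `abs_measureReal_compl_iUnion_sub_exp_le` reduces this to pairs of tuples with a common point.
Raising to the `m`-th power collapses a regular `m`-gon to one point, so in a tuple of small deficit
all `m`-th powers are `O(e)`-close (`dist_pow_pow_le`). Two overlapping good tuples with `r` points
in all therefore put `r - 1` independent points in sets of probability `O(e)`. There are `O(n^r)`
such pairs, and `n^r e^(r-1) → 0` for `r > m`. -/

noncomputable section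

/-! ### Poisson approximation of the probability that none of finitely many events occurs -/

/-- The solution of the Stein equation of the Poisson law with parameter `l` for the set `{0}`. -/
def steinSolution (l : ℝ) (w : ℕ) : ℝ := ∫ x in (0 : ℝ)..1, x ^ w * Real.exp (-l * x)

theorem intervalIntegrable_steinSolution (l : ℝ) (w : ℕ) (a b : ℝ) :
    IntervalIntegrable (fun x : ℝ => x ^ w * Real.exp (-l * x)) volume a b :=
  Continuous.intervalIntegrable (by fun_prop) _ _

theorem steinSolution_nonneg (l : ℝ) (w : ℕ) : 0 ≤ steinSolution l w := by
  refine intervalIntegral.integral_nonneg zero_le_one fun x hx => ?_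
  have := hx.1
  positivity

theorem steinSolution_antitone (l : ℝ) : Antitone (steinSolution l) := by
  intro v w hvw
  refine intervalIntegral.integral_mono_on zero_le_one (intervalIntegrable_steinSolution ..)
    (intervalIntegrable_steinSolution ..) fun x hx => ?_
  exact mul_le_mul_of_nonneg_right (pow_le_pow_of_le_one hx.1 hx.2 hvw) (Real.exp_nonneg _)

theorem steinSolution_le_one {l : ℝ} (hl : 0 ≤ l) (w : ℕ) : steinSolution l w ≤ 1 := by
  have h : steinSolution l w ≤ ∫ _ in (0 : ℝ)..1, (1 : ℝ) := by
    refine intervalIntegral.integral_mono_on zero_le_one (intervalIntegrable_steinSolution ..)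
      (by simp) fun x hx => ?_
    refine mul_le_one₀ (pow_le_one₀ hx.1 hx.2) (Real.exp_nonneg _) ?_
    rw [Real.exp_le_one_iff]
    nlinarith [hx.1]
  simpa using h

/-- The left side is the integral over `[0, 1]` of the derivative of `-x^w exp(-l x)`; the boundary
term `0^w` supplies the indicator of `w = 0`. The truncated `w - 1` is harmless at `w = 0`, where
its coefficient vanishes. -/
theorem steinSolution_eq (l : ℝ) (w : ℕ) :
    l * steinSolution l w - w * steinSolution l (w - 1) =
      (if w = 0 then 1 else 0) - Real.exp (-l) := by
  have h : ∀ x ∈ Set.uIcc (0 : ℝ) 1, HasDerivAt (fun x : ℝ => -(x ^ w * Real.exp (-l * x)))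
      (l * (x ^ w * Real.exp (-l * x)) - w * (x ^ (w - 1) * Real.exp (-l * x))) x := by
    intro x _
    have h1 : HasDerivAt (fun x : ℝ => Real.exp (-l * x)) (Real.exp (-l * x) * (-l)) x := by
      simpa using ((hasDerivAt_id x).const_mul (-l)).exp
    convert! ((hasDerivAt_pow w x).mul h1).neg using 1
    ring
  have := intervalIntegral.integral_eq_sub_of_hasDerivAt h
    (Continuous.intervalIntegrable (by fun_prop) _ _)
  rw [intervalIntegral.integral_sub (Continuous.intervalIntegrable (by fun_prop) _ _)
    (Continuous.intervalIntegrable (by fun_prop) _ _), intervalIntegral.integral_const_mul,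
    intervalIntegral.integral_const_mul] at this
  unfold steinSolution
  rw [this]
  by_cases hw : w = 0
  · simp [hw]; ring
  · simp [hw]

/-- Values in `[0, 1]` differ by at most `1`, hence by at most `z` as soon as `z ≥ 1`. The bound by
`z` turns differences of the Stein solution into counts of events. -/
theorem abs_steinSolution_add_sub_le {l : ℝ} (hl : 0 ≤ l) (v z : ℕ) :
    |steinSolution l (v + z) - steinSolution l v| ≤ z := by
  rcases Nat.eq_zero_or_pos z with rfl | hz
  · simp
  · have h1 : (1 : ℝ) ≤ z := by exact_mod_cast hz
    have h2 := steinSolution_antitone l (Nat.le_add_right v z)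
    have h3 := steinSolution_le_one hl v
    have h4 := steinSolution_nonneg l (v + z)
    rw [abs_le]; constructor <;> linarith

/-- A Poisson approximation in the manner of Chen and Stein: if every `A a` is independent of the
number of events that occur among those outside its neighbourhood `N a`, then the probability
that no event occurs is close to `exp (-∑ a, μ (A a))`. -/
theorem abs_measureReal_compl_iUnion_sub_exp_le {Ω ι : Type*} [MeasurableSpace Ω] (μ : Measure Ω)
    [IsProbabilityMeasure μ] [Fintype ι] [DecidableEq ι] (A : ι → Set Ω)
    (hA : ∀ a, MeasurableSet (A a)) (N : ι → Finset ι) (hN : ∀ a, a ∈ N a)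
    (hind : ∀ a, IndepFun ((A a).indicator (1 : Ω → ℕ))
      (fun ω => ∑ b ∈ (N a)ᶜ, (A b).indicator (1 : Ω → ℕ) ω) μ) :
    |μ.real (⋃ a, A a)ᶜ - Real.exp (-∑ a, μ.real (A a))| ≤
      ∑ a, ∑ b ∈ N a, μ.real (A a) * μ.real (A b) +
      ∑ a, ∑ b ∈ (N a).erase a, μ.real (A a ∩ A b) := by
  set l := ∑ a, μ.real (A a) with hl_def
  have hl : 0 ≤ l := Finset.sum_nonneg fun a _ => measureReal_nonneg
  set F := steinSolution l with hF
  set I : ι → Ω → ℕ := fun a => (A a).indicator (1 : Ω → ℕ) with hI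
  have hImeas : ∀ a, Measurable (I a) := fun a => measurable_const.indicator (hA a)
  set W : Ω → ℕ := fun ω => ∑ b, I b ω with hW
  set V : ι → Ω → ℕ := fun a ω => ∑ b ∈ (N a)ᶜ, I b ω with hV
  have hWmeas : Measurable W := Finset.measurable_fun_sum _ fun b _ => hImeas b
  have hVmeas : ∀ a, Measurable (V a) := fun a => Finset.measurable_fun_sum _ fun b _ => hImeas b
  have hFmeas : Measurable F := measurable_from_top
  have hFb : ∀ w, ‖F w‖ ≤ 1 := fun w => by
    rw [Real.norm_of_nonneg (steinSolution_nonneg l w)]; exact steinSolution_le_one hl w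
  have hFint : ∀ (G : Ω → ℕ), Measurable G → Integrable (fun ω => F (G ω)) μ := fun G hG =>
    Integrable.of_bound (hFmeas.comp hG).aestronglyMeasurable 1 (ae_of_all _ fun ω => hFb _)
  have hcast : Measurable (fun n : ℕ => (n : ℝ)) := measurable_from_top
  have hI01 : ∀ a ω, I a ω = 0 ∨ I a ω = 1 := fun a ω => by
    by_cases h : ω ∈ A a <;> simp [hI, h]
  have hIle : ∀ a ω, ‖(I a ω : ℝ)‖ ≤ 1 := fun a ω => by
    rcases hI01 a ω with h | h <;> simp [h]
  have hIreal : ∀ a ω, (I a ω : ℝ) = (A a).indicator 1 ω := fun a ω => by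
    by_cases h : ω ∈ A a <;> simp [hI, h]
  have hIint : ∀ a, Integrable (fun ω => (I a ω : ℝ)) μ := fun a =>
    Integrable.of_bound (hcast.comp (hImeas a)).aestronglyMeasurable 1 (ae_of_all _ (hIle a))
  have hIE : ∀ a, ∫ ω, (I a ω : ℝ) ∂μ = μ.real (A a) := fun a => by
    simp_rw [hIreal]; exact integral_indicator_one (hA a)
  have hIFint : ∀ a (G : Ω → ℕ), Measurable G → Integrable (fun ω => (I a ω : ℝ) * F (G ω)) μ :=
    fun a G hG => (hFint G hG).bdd_mul (hcast.comp (hImeas a)).aestronglyMeasurable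
      (ae_of_all _ (hIle a))
  have hIIint : ∀ a b, Integrable (fun ω => (I a ω : ℝ) * (I b ω : ℝ)) μ :=
    fun a b => (hIint b).bdd_mul (hcast.comp (hImeas a)).aestronglyMeasurable
      (ae_of_all _ (hIle a))
  have hIIE : ∀ a b, ∫ ω, (I a ω : ℝ) * (I b ω : ℝ) ∂μ = μ.real (A a ∩ A b) := fun a b => by
    simp_rw [hIreal]
    rw [← integral_indicator_one ((hA a).inter (hA b))]
    congr 1; ext ω
    by_cases h : ω ∈ A a <;> by_cases h' : ω ∈ A b <;> simp [h, h']
  -- The Stein equation at the number `W` of events that occur, integrated.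
  have hprob : μ.real (⋃ a, A a)ᶜ - Real.exp (-l) =
      ∫ ω, (l * F (W ω) - ∑ a, (I a ω : ℝ) * F (W ω - 1)) ∂μ := by
    have h1 : ∀ ω, l * F (W ω) - ∑ a, (I a ω : ℝ) * F (W ω - 1) =
        ((⋃ a, A a)ᶜ).indicator 1 ω - Real.exp (-l) := by
      intro ω
      rw [← Finset.sum_mul, ← Nat.cast_sum, steinSolution_eq]
      congr 1
      by_cases h : W ω = 0
      · have h' : ω ∈ (⋃ a, A a)ᶜ := by
          have h0 : ∀ a, I a ω = 0 := by simpa [hW] using h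
          simpa [hI] using h0
        rw [if_pos h, Set.indicator_of_mem h']; rfl
      · have h' : ω ∉ (⋃ a, A a)ᶜ := fun hc => h (by
          have : ∀ a, ω ∉ A a := by simpa using hc
          simp [hW, hI, this])
        rw [if_neg h, Set.indicator_of_notMem h']
    simp_rw [h1]
    have hm : MeasurableSet (⋃ a, A a)ᶜ := (MeasurableSet.iUnion hA).compl
    have hi : Integrable ((⋃ a, A a)ᶜ.indicator (1 : Ω → ℝ)) μ :=
      (integrable_const (1 : ℝ)).indicator hm
    rw [integral_sub hi (integrable_const _), integral_indicator_one hm]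
    simp
  have hW1 : Measurable fun ω => W ω - 1 :=
    measurable_from_top.comp (g := fun n : ℕ => n - 1) hWmeas
  have hsplit : ∫ ω, (l * F (W ω) - ∑ a, (I a ω : ℝ) * F (W ω - 1)) ∂μ =
      ∑ a, (μ.real (A a) * ∫ ω, F (W ω) ∂μ - ∫ ω, (I a ω : ℝ) * F (W ω - 1) ∂μ) := by
    rw [integral_sub ((hFint W hWmeas).const_mul l)
      (integrable_finsetSum _ fun a _ => hIFint a _ hW1), integral_const_mul,
      integral_finsetSum _ fun a _ => hIFint a _ hW1, Finset.sum_sub_distrib, ← Finset.sum_mul]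
  -- The only use of independence. It makes the terms in `V a` cancel once `F (W)` and `F (W - 1)`
  -- are both compared with `F (V a)`.
  have hEind : ∀ a, ∫ ω, (I a ω : ℝ) * F (V a ω) ∂μ = μ.real (A a) * ∫ ω, F (V a ω) ∂μ := by
    intro a
    rw [← hIE a]
    exact ((hind a).comp hcast hFmeas).integral_fun_mul_eq_mul_integral
      (hcast.comp (hImeas a)).aestronglyMeasurable (hFmeas.comp (hVmeas a)).aestronglyMeasurable
  have hWV : ∀ a ω, W ω = V a ω + ∑ b ∈ N a, I b ω := fun a ω =>
    (Finset.sum_compl_add_sum (N a) fun b => I b ω).symm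
  have hterm1 : ∀ a, |μ.real (A a) * ∫ ω, F (W ω) ∂μ - μ.real (A a) * ∫ ω, F (V a ω) ∂μ| ≤
      ∑ b ∈ N a, μ.real (A a) * μ.real (A b) := by
    intro a
    rw [← mul_sub, abs_mul, abs_of_nonneg measureReal_nonneg, ← Finset.mul_sum,
      ← integral_sub (hFint W hWmeas) (hFint _ (hVmeas a))]
    refine mul_le_mul_of_nonneg_left ?_ measureReal_nonneg
    calc |∫ ω, (F (W ω) - F (V a ω)) ∂μ| ≤ ∫ ω, |F (W ω) - F (V a ω)| ∂μ :=
          abs_integral_le_integral_abs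
      _ ≤ ∫ ω, ∑ b ∈ N a, (I b ω : ℝ) ∂μ := by
          refine integral_mono ((hFint W hWmeas).sub (hFint _ (hVmeas a))).abs
            (integrable_finsetSum _ fun b _ => hIint b) fun ω => ?_
          have := abs_steinSolution_add_sub_le hl (V a ω) (∑ b ∈ N a, I b ω)
          simp only [hWV a ω]
          exact_mod_cast this
      _ = ∑ b ∈ N a, μ.real (A b) := by
          rw [integral_finsetSum _ fun b _ => hIint b]; simp_rw [hIE]
  have hterm2 : ∀ a, |∫ ω, (I a ω : ℝ) * F (V a ω) ∂μ - ∫ ω, (I a ω : ℝ) * F (W ω - 1) ∂μ| ≤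
      ∑ b ∈ (N a).erase a, μ.real (A a ∩ A b) := by
    intro a
    rw [← integral_sub (hIFint a _ (hVmeas a)) (hIFint a _ hW1)]
    calc |∫ ω, ((I a ω : ℝ) * F (V a ω) - (I a ω : ℝ) * F (W ω - 1)) ∂μ|
        ≤ ∫ ω, |(I a ω : ℝ) * F (V a ω) - (I a ω : ℝ) * F (W ω - 1)| ∂μ :=
          abs_integral_le_integral_abs
      _ ≤ ∫ ω, ∑ b ∈ (N a).erase a, (I a ω : ℝ) * (I b ω : ℝ) ∂μ := by
          refine integral_mono ((hIFint a _ (hVmeas a)).sub (hIFint a _ hW1)).abs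
            (integrable_finsetSum _ fun b _ => hIIint a b) fun ω => ?_
          rcases hI01 a ω with h | h
          · simp [h]
          -- When `A a` occurs, the subtracted `1` is its own contribution to `W`, so only the other
          -- neighbours of `a` remain.
          · have h2 : W ω - 1 = V a ω + ∑ b ∈ (N a).erase a, I b ω := by
              rw [hWV a ω, ← Finset.add_sum_erase _ _ (hN a), h]; omega
            have := abs_steinSolution_add_sub_le hl (V a ω) (∑ b ∈ (N a).erase a, I b ω)
            simp only [h, h2, Nat.cast_one, one_mul]
            rw [abs_sub_comm]
            exact_mod_cast this
      _ = ∑ b ∈ (N a).erase a, μ.real (A a ∩ A b) := by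
          rw [integral_finsetSum _ fun b _ => hIIint a b]; simp_rw [hIIE]
  rw [hprob, hsplit, ← Finset.sum_add_distrib]
  refine (Finset.abs_sum_le_sum_abs _ _).trans (Finset.sum_le_sum fun a _ => ?_)
  refine le_trans ?_ (add_le_add (hterm1 a) (hterm2 a))
  rw [hEind]
  refine le_trans (le_of_eq ?_) (abs_add_le _ _)
  congr 1; ring

/-! ### The gap between a strictly concave function and its tangent line -/

/-- The vertical distance at `a + d` from the graph of `g` up to its tangent line at `a`. -/
def tangentGap (g : ℝ → ℝ) (a d : ℝ) : ℝ := g a + deriv g a * d - g (a + d)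

@[simp] theorem tangentGap_zero (g : ℝ → ℝ) (a : ℝ) : tangentGap g a 0 = 0 := by
  simp [tangentGap]

theorem tendsto_tangentGap_div_sq {g : ℝ → ℝ} {a : ℝ} (hg : ContDiffAt ℝ 2 g a) :
    Tendsto (fun d => tangentGap g a d / d ^ 2) (𝓝[≠] 0) (𝓝 (-iteratedDeriv 2 g a / 2)) := by
  obtain ⟨r, hr, hgr⟩ : ∃ r > 0, ContDiffOn ℝ 2 g (Metric.ball a r) := by
    obtain ⟨u, hu, hgu⟩ := hg.contDiffOn (m := 2) le_rfl (by simp)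
    obtain ⟨r, hr, hru⟩ := Metric.mem_nhds_iff.1 hu
    exact ⟨r, hr, hgu.mono hru⟩
  have hmem : Metric.ball a r ∈ 𝓝 a := Metric.ball_mem_nhds a hr
  have ha : a ∈ Metric.ball a r := Metric.mem_ball_self hr
  have h := Real.taylor_tendsto (n := 2) (convex_ball a r) ha (by exact_mod_cast hgr)
  rw [nhdsWithin_eq_nhds.2 hmem] at h
  have hd : iteratedDerivWithin 2 g (Metric.ball a r) a = iteratedDeriv 2 g a :=
    iteratedDerivWithin_of_isOpen Metric.isOpen_ball ha
  have hd1 : iteratedDerivWithin 1 g (Metric.ball a r) a = deriv g a := by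
    rw [iteratedDerivWithin_of_isOpen Metric.isOpen_ball ha, iteratedDeriv_one]
  have hT : ∀ x, taylorWithinEval g 2 (Metric.ball a r) a x =
      g a + deriv g a * (x - a) + iteratedDeriv 2 g a / 2 * (x - a) ^ 2 := by
    intro x
    rw [taylorWithinEval_succ, taylorWithinEval_succ, taylor_within_zero_eval]
    simp only [zero_add, hd1, show (1 : ℕ) + 1 = 2 from rfl, hd, smul_eq_mul]
    norm_num
    ring
  have h2 : Tendsto (fun d : ℝ => a + d) (𝓝[≠] 0) (𝓝 a) := by
    have : Tendsto (fun d : ℝ => a + d) (𝓝 0) (𝓝 (a + 0)) := by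
      exact (continuous_const.add continuous_id).tendsto 0
    rw [add_zero] at this
    exact this.mono_left nhdsWithin_le_nhds
  have h3 := (h.comp h2).const_sub (-iteratedDeriv 2 g a / 2)
  rw [sub_zero] at h3
  refine h3.congr' ?_
  filter_upwards [self_mem_nhdsWithin] with d hd0
  have hd0 : d ≠ 0 := hd0
  simp only [Function.comp, hT, tangentGap, add_sub_cancel_left]
  field_simp
  ring

theorem tendsto_tangentGap_mul_div_sq {g : ℝ → ℝ} {a : ℝ} (hg : ContDiffAt ℝ 2 g a) (w : ℝ) :
    Tendsto (fun e => tangentGap g a (e * w) / e ^ 2) (𝓝[>] 0)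
      (𝓝 (-iteratedDeriv 2 g a / 2 * w ^ 2)) := by
  rcases eq_or_ne w 0 with rfl | hw
  · simp
  have h1 : Tendsto (fun e : ℝ => e * w) (𝓝[>] 0) (𝓝[≠] 0) := by
    refine tendsto_nhdsWithin_iff.2 ⟨?_, ?_⟩
    · have : Tendsto (fun e : ℝ => e * w) (𝓝 0) (𝓝 (0 * w)) :=
        (continuous_id.mul continuous_const).tendsto 0
      rw [zero_mul] at this
      exact this.mono_left nhdsWithin_le_nhds
    · filter_upwards [self_mem_nhdsWithin] with e he
      exact mul_ne_zero (ne_of_gt he) hw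
  refine (((tendsto_tangentGap_div_sq hg).comp h1).mul_const (w ^ 2)).congr' ?_
  filter_upwards [self_mem_nhdsWithin] with e he
  have he : e ≠ 0 := ne_of_gt he
  simp only [Function.comp]
  field_simp

theorem StrictConcaveOn.tangentGap_pos {g : ℝ → ℝ} {s : Set ℝ} (hg : StrictConcaveOn ℝ s g)
    {a d : ℝ} (ha : a ∈ s) (had : a + d ∈ s) (hga : DifferentiableAt ℝ g a) (hd : d ≠ 0) :
    0 < tangentGap g a d := by
  rcases lt_or_gt_of_ne hd with h | h
  · have := hg.lt_slope_of_hasDerivAt had ha (by linarith) hga.hasDerivAt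
    rw [slope_def_field, lt_div_iff₀ (by linarith)] at this
    unfold tangentGap
    linarith
  · have := hg.slope_lt_of_hasDerivAt ha had (by linarith) hga.hasDerivAt
    rw [slope_def_field, div_lt_iff₀ (by linarith)] at this
    unfold tangentGap
    linarith

/-- The ratio of the positive tangent gap to `d²` tends to `-g''/2`, which is thus nonnegative;
nondegeneracy makes it positive. -/
theorem StrictConcaveOn.iteratedDeriv_two_neg {g : ℝ → ℝ} {s : Set ℝ}
    (hg : StrictConcaveOn ℝ s g) {a : ℝ} (ha : s ∈ 𝓝 a) (hga : ContDiffAt ℝ 2 g a)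
    (h0 : iteratedDeriv 2 g a ≠ 0) : iteratedDeriv 2 g a < 0 := by
  refine lt_of_le_of_ne ?_ h0
  have h := tendsto_tangentGap_div_sq hga
  have h2 : Tendsto (fun d : ℝ => a + d) (𝓝[≠] 0) (𝓝 a) := by
    have : Tendsto (fun d : ℝ => a + d) (𝓝 0) (𝓝 (a + 0)) := by
      exact (continuous_const.add continuous_id).tendsto 0
    rw [add_zero] at this
    exact this.mono_left nhdsWithin_le_nhds
  have : 0 ≤ -iteratedDeriv 2 g a / 2 := by
    refine ge_of_tendsto h ?_
    filter_upwards [self_mem_nhdsWithin, h2 ha] with d hd hs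
    exact (div_pos (hg.tangentGap_pos (mem_of_mem_nhds ha) hs
      (hga.differentiableAt (by norm_num)) hd) (by have : d ≠ 0 := hd; positivity)).le
  linarith

/-- On a compact set, the tangent line is above a strictly concave function by at least a
multiple of the squared distance. -/
theorem StrictConcaveOn.exists_mul_sq_le_tangentGap {g : ℝ → ℝ} {s : Set ℝ}
    (hg : StrictConcaveOn ℝ s g) (hs : IsCompact s) (hgs : ContinuousOn g s) {a : ℝ}
    (ha : s ∈ 𝓝 a) (hga : ContDiffAt ℝ 2 g a) (h0 : iteratedDeriv 2 g a ≠ 0) :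
    ∃ c > 0, ∀ d, a + d ∈ s → c * d ^ 2 ≤ tangentGap g a d := by
  have hneg := hg.iteratedDeriv_two_neg ha hga h0
  have hdiff : DifferentiableAt ℝ g a := hga.differentiableAt (by norm_num)
  set k := -iteratedDeriv 2 g a / 2 with hk
  have hkpos : 0 < k := by linarith
  have h1 := (tendsto_tangentGap_div_sq hga).eventually (lt_mem_nhds (half_lt_self hkpos))
  rw [eventually_nhdsWithin_iff, Metric.eventually_nhds_iff] at h1
  obtain ⟨r, hr, hr'⟩ := h1
  -- Near `a` the ratio of the gap to `d²` exceeds half its limit. Away from `a`, on the compact set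
  -- `T`, it is continuous and positive, so it has a positive minimum.
  set T := {x ∈ s | r ≤ |x - a|} with hT
  have hTc : IsCompact T := hs.inter_right
    (isClosed_le continuous_const (continuous_id.sub continuous_const).abs)
  have hcont : ContinuousOn (fun x => tangentGap g a (x - a) / (x - a) ^ 2) T := by
    refine ContinuousOn.div ?_ (by fun_prop) fun x hx => ?_
    · unfold tangentGap
      simp only [add_sub_cancel]
      refine ContinuousOn.sub (by fun_prop) (hgs.mono fun x hx => hx.1)
    · have : 0 < |x - a| := hr.trans_le hx.2
      exact pow_ne_zero 2 (abs_pos.1 this)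
  have hTbound : ∃ c > 0, ∀ x ∈ T, c ≤ tangentGap g a (x - a) / (x - a) ^ 2 := by
    rcases T.eq_empty_or_nonempty with he | hne
    · exact ⟨1, one_pos, by simp [he]⟩
    · obtain ⟨x0, hx0, hmin⟩ := hTc.exists_isMinOn hne hcont
      refine ⟨_, ?_, hmin⟩
      have hx0' : x0 - a ≠ 0 := abs_pos.1 (hr.trans_le hx0.2)
      exact div_pos (hg.tangentGap_pos (mem_of_mem_nhds ha) (by simpa using hx0.1) hdiff hx0')
        (by positivity)
  obtain ⟨c, hc, hcT⟩ := hTbound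
  refine ⟨min c (k / 2), lt_min hc (by linarith), fun d hd => ?_⟩
  rcases eq_or_ne d 0 with rfl | hd0
  · simp
  have hd2 : 0 < d ^ 2 := by positivity
  rw [← le_div_iff₀ hd2]
  by_cases hdr : |d| < r
  · exact (min_le_right _ _).trans (hr' (by simpa using hdr) hd0).le
  · refine (min_le_left _ _).trans ?_
    simpa using hcT (a + d) ⟨hd, by simpa using hdr⟩

/-! ### Gaps between sorted angles -/

/-- The consecutive gaps of a tuple of angles once it is sorted, the last one being up to `2π`. -/
def sortedGap {m : ℕ} (b : Fin m → ℝ) (i : Fin m) : ℝ :=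
  (if h : (i : ℕ) + 1 < m then (b ∘ Tuple.sort b) ⟨i + 1, h⟩ else 2 * π) - (b ∘ Tuple.sort b) i

theorem sortedGap_comp_perm {m : ℕ} (b : Fin m → ℝ) (σ : Equiv.Perm (Fin m)) :
    sortedGap (b ∘ σ) = sortedGap b := by
  ext i
  simp only [sortedGap, Tuple.comp_perm_comp_sort_eq_comp_sort]

theorem sortedGap_of_monotone {m : ℕ} {b : Fin m → ℝ} (hb : Monotone b) (i : Fin m) :
    sortedGap b i = (if h : (i : ℕ) + 1 < m then b ⟨i + 1, h⟩ else 2 * π) - b i := by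
  have : b ∘ Tuple.sort b = b := by
    rw [Tuple.sort_eq_refl_iff_monotone.2 hb]; rfl
  simp only [sortedGap, this]

section

variable {m : ℕ} {b : Fin m → ℝ}

theorem sortedGap_nonneg (hb : ∀ j, b j ≤ 2 * π) (i : Fin m) : 0 ≤ sortedGap b i := by
  unfold sortedGap
  split_ifs with h
  · exact sub_nonneg.2 (Tuple.monotone_sort b (Fin.mk_le_mk.2 (Nat.le_succ _)))
  · exact sub_nonneg.2 (hb _)

theorem sortedGap_le (hb0 : ∀ j, 0 ≤ b j) (hb : ∀ j, b j ≤ 2 * π) (i : Fin m) :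
    sortedGap b i ≤ 2 * π := by
  unfold sortedGap
  have h0 := hb0 (Tuple.sort b i)
  split_ifs with h
  · have := hb (Tuple.sort b ⟨i + 1, h⟩)
    simp only [Function.comp]; linarith
  · simp only [Function.comp]; linarith

/-- The sum telescopes, starting from the smallest angle, which is `b 0 = 0`. -/
theorem sum_sortedGap_lt [NeZero m] (hb0 : ∀ j, 0 ≤ b j) (hb : b 0 = 0) (i : Fin m) :
    (b ∘ Tuple.sort b) i = ∑ j : Fin m, if j < i then sortedGap b j else 0 := by
  have hzero : (b ∘ Tuple.sort b) 0 = 0 := by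
    refine le_antisymm ?_ (hb0 _)
    have := Tuple.monotone_sort b (Fin.zero_le ((Tuple.sort b).symm 0))
    simpa [hb] using this
  obtain ⟨i, hi⟩ := i
  induction i with
  | zero =>
    have h0 : (⟨0, hi⟩ : Fin m) = 0 := by ext; simp
    rw [h0, hzero]
    simp
  | succ i ih =>
    have hi' : i < m := by omega
    have hs : ∀ j : Fin m, (if j < ⟨i + 1, hi⟩ then sortedGap b j else 0) =
        (if j < ⟨i, hi'⟩ then sortedGap b j else 0) +
          if j = ⟨i, hi'⟩ then sortedGap b j else 0 := by
      intro j
      rcases lt_trichotomy j ⟨i, hi'⟩ with h | h | h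
      · have h1 : j < ⟨i + 1, hi⟩ := h.trans (by simp)
        simp [h, h1, h.ne]
      · simp [h]
      · have h1 : ¬ j < ⟨i + 1, hi⟩ := by
          simp only [Fin.lt_def] at h ⊢; omega
        simp [h1, h.not_gt, h.ne']
    simp_rw [hs, Finset.sum_add_distrib, ← ih hi', Finset.sum_ite_eq', Finset.mem_univ, if_true]
    simp [sortedGap, hi]

theorem sum_sortedGap [NeZero m] (hb0 : ∀ j, 0 ≤ b j) (hb : b 0 = 0) :
    ∑ i, sortedGap b i = 2 * π := by
  have hm : 0 < m := Nat.pos_of_ne_zero (NeZero.ne m)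
  have hlast : m - 1 < m := by omega
  have h := sum_sortedGap_lt hb0 hb ⟨m - 1, hlast⟩
  have hs : ∀ j : Fin m, sortedGap b j =
      (if j < ⟨m - 1, hlast⟩ then sortedGap b j else 0) +
        if j = ⟨m - 1, hlast⟩ then sortedGap b j else 0 := by
    intro j
    rcases lt_trichotomy j ⟨m - 1, hlast⟩ with h | h | h
    · simp [h, h.ne]
    · simp [h]
    · have := j.2
      simp only [Fin.lt_def] at h; omega
  rw [Finset.sum_congr rfl fun j _ => hs j, Finset.sum_add_distrib, ← h, Finset.sum_ite_eq']
  have : ¬ m - 1 + 1 < m := by omega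
  simp [sortedGap, this]

/-- A sorted angle is a sum of at most `m` consecutive gaps, so the individual errors `d` add up to
at most `m * d`. -/
theorem abs_sort_sub_le [NeZero m] (hb0 : ∀ j, 0 ≤ b j) (hb : b 0 = 0) {d : ℝ}
    (hd : ∀ i, |sortedGap b i - 2 * π / m| ≤ d) (i : Fin m) :
    |(b ∘ Tuple.sort b) i - 2 * π * i / m| ≤ m * d := by
  have hd0 : 0 ≤ d := (abs_nonneg _).trans (hd 0)
  have h1 : (2 * π * i / m : ℝ) = ∑ j : Fin m, if j < i then 2 * π / m else 0 := by
    rw [← Finset.sum_filter, Finset.sum_const, nsmul_eq_mul, Finset.filter_gt_eq_Iio,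
      Fin.card_Iio]
    ring
  rw [h1, sum_sortedGap_lt hb0 hb, ← Finset.sum_sub_distrib]
  refine (Finset.abs_sum_le_sum_abs _ _).trans ?_
  calc _ ≤ ∑ j : Fin m, d := Finset.sum_le_sum fun j _ => by
        split_ifs
        · exact hd j
        · simpa using hd0
    _ = m * d := by simp

theorem exists_abs_sub_le [NeZero m] (hb0 : ∀ j, 0 ≤ b j) (hb : b 0 = 0) {d : ℝ}
    (hd : ∀ i, |sortedGap b i - 2 * π / m| ≤ d) (j : Fin m) :
    ∃ l : Fin m, |b j - 2 * π * l / m| ≤ m * d :=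
  ⟨(Tuple.sort b).symm j, by simpa using abs_sort_sub_le hb0 hb hd ((Tuple.sort b).symm j)⟩

/-- The deviations of the gaps from `2π / m` sum to zero, so adding the slope of the tangent line
times each of them changes nothing. -/
theorem sub_sum_sortedGap_eq [NeZero m] (hb0 : ∀ j, 0 ≤ b j) (hb : b 0 = 0) (g : ℝ → ℝ) :
    m * g (2 * π / m) - ∑ i, g (sortedGap b i) =
      ∑ i, tangentGap g (2 * π / m) (sortedGap b i - 2 * π / m) := by
  have hm : (m : ℝ) ≠ 0 := by exact_mod_cast NeZero.ne m
  have h2 : ∑ i : Fin m, deriv g (2 * π / m) * (sortedGap b i - 2 * π / m) = 0 := by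
    rw [← Finset.mul_sum, Finset.sum_sub_distrib, sum_sortedGap hb0 hb]
    simp only [Finset.sum_const, Finset.card_univ, Fintype.card_fin, nsmul_eq_mul]
    rw [mul_div_cancel₀ _ hm, sub_self, mul_zero]
  simp only [tangentGap, Finset.sum_sub_distrib, Finset.sum_add_distrib, h2, add_sub_cancel]
  simp

end

/-- Sorting agrees with a fixed permutation of coordinates on each of finitely many pieces; these
are cut out by inequalities together with the rule that breaks ties by index. -/
theorem measurable_sort {m : ℕ} : Measurable fun b : Fin m → ℝ => b ∘ Tuple.sort b := by
  have hset : ∀ σ : Equiv.Perm (Fin m), MeasurableSet {b : Fin m → ℝ | Tuple.sort b = σ} := by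
    intro σ
    have : {b : Fin m → ℝ | Tuple.sort b = σ} =
        {b | ∀ i j : Fin m, i ≤ j → b (σ i) ≤ b (σ j)} ∩
        {b | ∀ i j : Fin m, i < j → b (σ i) = b (σ j) → σ i < σ j} := by
      ext b
      rw [Set.mem_ofPred_eq, eq_comm, Tuple.eq_sort_iff]
      rfl
    rw [this]
    refine MeasurableSet.inter ?_ ?_
    · simp only [Set.ofPred_forall]
      refine MeasurableSet.iInter fun i => .iInter fun j => .iInter fun _ => ?_
      exact measurableSet_le (measurable_pi_apply _) (measurable_pi_apply _)
    · simp only [Set.ofPred_forall]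
      refine MeasurableSet.iInter fun i => .iInter fun j => .iInter fun _ => ?_
      simp only [imp_iff_not_or, Set.ofPred_or]
      refine .union ?_ (.const _)
      exact (measurableSet_eq_fun (f := fun b : Fin m → ℝ => b (σ i)) (g := fun b => b (σ j))
        (measurable_pi_apply _) (measurable_pi_apply _)).compl
  have h2 : (fun b : Fin m → ℝ => b ∘ Tuple.sort b) = fun b => ∑ σ : Equiv.Perm (Fin m),
      ({b : Fin m → ℝ | Tuple.sort b = σ}.indicator (fun b => b ∘ σ)) b := by
    ext1 b
    rw [Finset.sum_eq_single (Tuple.sort b)]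
    · simp
    · intro σ _ h
      simp [h.symm]
    · simp
  rw [h2]
  refine Finset.measurable_fun_sum _ fun σ _ => Measurable.indicator ?_ (hset σ)
  exact measurable_pi_lambda _ fun i => measurable_pi_apply _

theorem measurable_sortedGap {m : ℕ} (i : Fin m) :
    Measurable fun b : Fin m → ℝ => sortedGap b i := by
  have h : ∀ j : Fin m, Measurable fun b : Fin m → ℝ => (b ∘ Tuple.sort b) j := fun j =>
    (measurable_pi_apply j).comp measurable_sort
  unfold sortedGap
  split_ifs with hi
  · exact (h _).sub (h _)
  · exact measurable_const.sub (h _)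

/-! ### Central angles -/

theorem centralAngle_mem (u v : Circle) : centralAngle u v ∈ Set.Ico 0 (2 * π) := by
  have := toIcoMod_mem_Ico Real.two_pi_pos 0 (Complex.arg ((v / u : Circle) : ℂ))
  rwa [zero_add] at this

theorem exp_centralAngle (u v : Circle) : Circle.exp (centralAngle u v) = v / u := by
  unfold centralAngle
  rw [← self_sub_toIcoDiv_zsmul, zsmul_eq_mul, Circle.exp_sub]
  rw [Circle.exp_arg]
  simp

theorem centralAngle_exp_add (a : ℝ) {y : ℝ} (hy : y ∈ Set.Ico 0 (2 * π)) :
    centralAngle (Circle.exp a) (Circle.exp (a + y)) = y := by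
  have h := exp_centralAngle (Circle.exp a) (Circle.exp (a + y))
  rw [Circle.exp_add, mul_div_cancel_left] at h
  obtain ⟨n, hn⟩ := Circle.exp_eq_exp.1 h
  rw [← Circle.exp_add] at hn
  have hc := centralAngle_mem (Circle.exp a) (Circle.exp (a + y))
  have h1 : ((n : ℤ) : ℝ) < 1 := by nlinarith [hc.2, hy.1, Real.pi_pos]
  have h2 : (-1 : ℝ) < ((n : ℤ) : ℝ) := by nlinarith [hc.1, hy.2, Real.pi_pos]
  have h3 : n = 0 := by
    have h4 : n < 1 := by exact_mod_cast h1
    have h5 : -1 < n := by exact_mod_cast h2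
    omega
  rw [hn, h3]
  simp

@[simp] theorem centralAngle_self (u : Circle) : centralAngle u u = 0 := by
  unfold centralAngle
  rw [div_self']
  simp

theorem measurable_centralAngle : Measurable fun z : Circle × Circle => centralAngle z.1 z.2 := by
  unfold centralAngle
  simp_rw [toIcoMod_eq_fract_mul]
  have h1 : Measurable fun z : Circle × Circle => ((z.2 / z.1 : Circle) : ℂ) := by
    have h2 : Continuous fun z : Circle => (z : ℂ) := by fun_prop
    exact (h2.comp (continuous_snd.div' continuous_fst)).measurable
  exact (measurable_fract.comp ((Complex.measurable_arg.comp h1).div_const _)).mul_const _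

theorem sortedGap_mem_Icc {m : ℕ} {b : Fin m → ℝ} (hb : ∀ j, b j ∈ Set.Ico 0 (2 * π)) (i : Fin m) :
    sortedGap b i ∈ Set.Icc 0 (2 * π) :=
  ⟨sortedGap_nonneg (fun j => (hb j).2.le) i,
    sortedGap_le (fun j => (hb j).1) (fun j => (hb j).2.le) i⟩

/-! ### Tuples of points close to a regular polygon -/

theorem Circle.dist_exp_eq (a b : ℝ) :
    dist (Circle.exp a) (Circle.exp b) = |2 * Real.sin ((a - b) / 2)| := by
  have h1 : dist (Circle.exp a) (Circle.exp b) = ‖((Circle.exp a : ℂ)) - (Circle.exp b : ℂ)‖ := by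
    rw [← dist_eq_norm]; rfl
  have h2 : (Circle.exp a : ℂ) - (Circle.exp b : ℂ) =
      (Complex.exp (Complex.I * ((a - b : ℝ) : ℂ)) - 1) * (Circle.exp b : ℂ) := by
    rw [Circle.coe_exp, Circle.coe_exp, sub_mul, ← Complex.exp_add, one_mul]
    congr 2
    push_cast; ring
  rw [h1, h2, norm_mul, Circle.norm_coe, mul_one, Complex.norm_exp_I_mul_ofReal_sub_one,
    Real.norm_eq_abs]

theorem Circle.dist_exp_le (a b : ℝ) : dist (Circle.exp a) (Circle.exp b) ≤ |a - b| := by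
  rw [Circle.dist_exp_eq, abs_mul, abs_two]
  have := Real.abs_sin_le_abs (x := (a - b) / 2)
  rw [abs_div, abs_two] at this
  linarith

theorem Circle.dist_mul_left (u v w : Circle) : dist (u * v) (u * w) = dist v w := by
  obtain ⟨a, rfl⟩ := Circle.exp_surjective u
  obtain ⟨b, rfl⟩ := Circle.exp_surjective v
  obtain ⟨c, rfl⟩ := Circle.exp_surjective w
  rw [← Circle.exp_add, ← Circle.exp_add, Circle.dist_exp_eq, Circle.dist_exp_eq,
    add_sub_add_left_eq_sub]

/-- Each angle from `u 0` is within `m * d` of a multiple of `2π / m`. The `m`-th power sends that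
multiple to `1` and stretches the error by `m`, so every `u j ^ m` is within `m² d` of `u 0 ^ m`. -/
theorem dist_pow_pow_le {m : ℕ} [NeZero m] {u : Fin m → Circle} {d : ℝ}
    (hd : ∀ i, |sortedGap (fun j => centralAngle (u 0) (u j)) i - 2 * π / m| ≤ d) (i j : Fin m) :
    dist (u i ^ m) (u j ^ m) ≤ 2 * m ^ 2 * d := by
  have hm : (m : ℝ) ≠ 0 := by exact_mod_cast NeZero.ne m
  have key : ∀ j, dist (u j ^ m) (u 0 ^ m) ≤ m ^ 2 * d := by
    intro j
    obtain ⟨l, hl⟩ := exists_abs_sub_le (b := fun j => centralAngle (u 0) (u j))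
      (fun j => (centralAngle_mem _ _).1) (centralAngle_self _) hd j
    have h1 : u j ^ m = u 0 ^ m * Circle.exp (m * centralAngle (u 0) (u j)) := by
      rw [← nsmul_eq_mul, Circle.exp_nsmul, exp_centralAngle, ← mul_pow, mul_div_cancel]
    have h2 : Circle.exp (m * (2 * π * l / m)) = 1 := by
      rw [mul_div_cancel₀ _ hm, mul_comm]
      exact_mod_cast Circle.exp_int_mul_two_pi (l : ℕ)
    calc dist (u j ^ m) (u 0 ^ m)
        = dist (Circle.exp (m * centralAngle (u 0) (u j))) (Circle.exp (m * (2 * π * l / m))) := by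
          rw [h2, h1]
          conv_lhs => rw [← mul_one (u 0 ^ m), mul_assoc, one_mul]
          rw [Circle.dist_mul_left]
      _ ≤ |m * centralAngle (u 0) (u j) - m * (2 * π * l / m)| := Circle.dist_exp_le _ _
      _ = m * |centralAngle (u 0) (u j) - 2 * π * l / m| := by
          rw [← mul_sub, abs_mul, Nat.abs_cast]
      _ ≤ m * (m * d) := mul_le_mul_of_nonneg_left hl (Nat.cast_nonneg _)
      _ = m ^ 2 * d := by ring
  calc dist (u i ^ m) (u j ^ m) ≤ dist (u i ^ m) (u 0 ^ m) + dist (u j ^ m) (u 0 ^ m) :=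
        dist_triangle_right _ _ _
    _ ≤ m ^ 2 * d + m ^ 2 * d := add_le_add (key i) (key j)
    _ = 2 * m ^ 2 * d := by ring

theorem circleLaw_le {p : ℝ → ℝ} {M : ℝ} (hM : ∀ x, p x ≤ M) {s : Set Circle}
    (hs : MeasurableSet s) :
    circleLaw p s ≤ ENNReal.ofReal M * volume (Circle.exp ⁻¹' s ∩ Set.Ico 0 (2 * π)) := by
  have hpre : MeasurableSet (Circle.exp ⁻¹' s) := Circle.exp.continuous.measurable hs
  rw [circleLaw, Measure.map_apply Circle.exp.continuous.measurable hs, withDensity_apply _ hpre,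
    Measure.restrict_restrict hpre]
  calc _ ≤ ∫⁻ _ in Circle.exp ⁻¹' s ∩ Set.Ico 0 (2 * π), ENNReal.ofReal M :=
        lintegral_mono fun x => ENNReal.ofReal_le_ofReal (hM x)
    _ = _ := by simp

/-- The set of angles is covered by `m + 2` intervals of radius `π d / (2m)` about the solutions `x`
of `m x ≡ ψ` modulo `2π`, Jordan's inequality bounding angles by chords. -/
theorem volume_dist_pow_le {m : ℕ} [NeZero m] (w : Circle) {d : ℝ} :
    volume (Circle.exp ⁻¹' {v : Circle | dist (v ^ m) w ≤ d} ∩ Set.Ico 0 (2 * π)) ≤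
      ENNReal.ofReal ((m + 2) * (π / m) * d) := by
  have hm : (0 : ℝ) < m := by exact_mod_cast Nat.pos_of_ne_zero (NeZero.ne m)
  set ψ := centralAngle 1 w with hψ
  have hψmem : ψ ∈ Set.Ico 0 (2 * π) := centralAngle_mem _ _
  have hw : w = Circle.exp ψ := by rw [exp_centralAngle, div_one]
  have hsub : Circle.exp ⁻¹' {v : Circle | dist (v ^ m) w ≤ d} ∩ Set.Ico 0 (2 * π) ⊆
      ⋃ k ∈ Finset.Icc (-1 : ℤ) m,
        Metric.closedBall ((ψ + 2 * π * k) / m) (π * d / (2 * m)) := by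
    rintro x ⟨hx1, hx0, hx2⟩
    have hx1 : dist (Circle.exp x ^ m) w ≤ d := hx1
    rw [hw, ← Circle.exp_nsmul, nsmul_eq_mul, Circle.dist_exp_eq] at hx1
    set θ := m * x - ψ with hθ
    -- Subtracting the nearest multiple of `2π` leaves an angle of size at most `π`, whose half lies
    -- in the range of Jordan's inequality. Since `-2π < θ < 2πm`, this `k` lies between `-1` and
    -- `m`.
    set k := round (θ / (2 * π)) with hk
    have hround := abs_sub_round (θ / (2 * π))
    rw [← hk] at hround
    have h2π : (0 : ℝ) < 2 * π := Real.two_pi_pos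
    have hθk : |θ - 2 * π * k| ≤ π := by
      have : θ - 2 * π * k = 2 * π * (θ / (2 * π) - k) := by
        rw [mul_sub, mul_div_cancel₀ _ h2π.ne']
      rw [this, abs_mul, abs_of_pos h2π]
      nlinarith
    have hθ1 : -(2 * π) < θ := by
      have : 0 ≤ m * x := by positivity
      linarith [hψmem.2]
    have hθ2 : θ < 2 * π * m := by
      have : m * x < m * (2 * π) := mul_lt_mul_of_pos_left hx2 hm
      linarith [hψmem.1]
    have hkb : k ∈ Finset.Icc (-1 : ℤ) m := by
      rw [abs_le] at hθk
      rw [Finset.mem_Icc]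
      have h1 : (-2 : ℝ) < k := by nlinarith [hθk.2, Real.pi_pos]
      have h2 : (k : ℝ) < m + 1 := by nlinarith [hθk.1, Real.pi_pos]
      have h1' : (-2 : ℤ) < k := by exact_mod_cast h1
      have h2' : k < (m : ℤ) + 1 := by exact_mod_cast h2
      constructor <;> omega
    have hsin : |Real.sin (θ / 2)| = |Real.sin ((θ - 2 * π * k) / 2)| := by
      have : (θ - 2 * π * k) / 2 = θ / 2 - k * π := by ring
      rw [this, Real.sin_sub_int_mul_pi, abs_mul]
      simp
    have hle := Real.mul_abs_le_abs_sin (x := (θ - 2 * π * k) / 2) (by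
      rw [abs_div, abs_two]; linarith)
    rw [← hsin, abs_div, abs_two] at hle
    rw [abs_mul, abs_two] at hx1
    have h4 : |θ - 2 * π * k| ≤ π * d / 2 := by
      have h5 : 2 / π * (|θ - 2 * π * k| / 2) ≤ d / 2 := by linarith
      have h6 : 2 / π * (|θ - 2 * π * k| / 2) = |θ - 2 * π * k| / π := by ring
      rw [h6, div_le_iff₀ Real.pi_pos] at h5
      linarith
    simp only [Set.mem_iUnion]
    refine ⟨k, hkb, ?_⟩
    rw [Metric.mem_closedBall, Real.dist_eq]
    have h7 : x - (ψ + 2 * π * k) / m = (θ - 2 * π * k) / m := by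
      rw [hθ]; field_simp; ring
    rw [h7, abs_div, abs_of_pos hm, div_le_div_iff₀ hm (by positivity)]
    nlinarith
  refine (measure_mono hsub).trans ((measure_biUnion_finset_le _ _).trans ?_)
  simp only [Real.volume_closedBall, Finset.sum_const, Int.card_Icc, nsmul_eq_mul]
  rw [← ENNReal.ofReal_natCast, ← ENNReal.ofReal_mul (Nat.cast_nonneg _)]
  refine ENNReal.ofReal_le_ofReal (le_of_eq ?_)
  have : ((m : ℤ) + 1 - -1).toNat = m + 2 := by omega
  rw [this]
  push_cast
  field_simp

theorem measurableSet_dist_pow_le (m : ℕ) (w : Circle) (d : ℝ) :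
    MeasurableSet {v : Circle | dist (v ^ m) w ≤ d} :=
  (isClosed_le (by fun_prop) continuous_const).measurableSet

/-- Under a law on the circle with bounded density, the `m`-th power of a point is within `d` of
a given point with probability `O(d)`. -/
theorem circleLaw_dist_pow_le {p : ℝ → ℝ} {M : ℝ} (hM : ∀ x, p x ≤ M) (hM0 : 0 ≤ M) {m : ℕ}
    [NeZero m] (w : Circle) (d : ℝ) :
    circleLaw p {v : Circle | dist (v ^ m) w ≤ d} ≤
      ENNReal.ofReal (M * ((m + 2) * (π / m)) * d) := by
  refine (circleLaw_le hM (measurableSet_dist_pow_le m w d)).trans ?_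
  rw [mul_assoc, ENNReal.ofReal_mul hM0]
  gcongr
  exact volume_dist_pow_le w

/-! ### Poisson approximation for `U`-max statistics -/

/-- The finset of values of an order embedding. -/
def rangeFinset {m n : ℕ} (a : Fin m ↪o Fin n) : Finset (Fin n) :=
  Finset.univ.map a.toEmbedding

theorem mem_rangeFinset {m n : ℕ} {a : Fin m ↪o Fin n} {i : Fin n} :
    i ∈ rangeFinset a ↔ ∃ j, a j = i := by simp [rangeFinset]

theorem card_rangeFinset {m n : ℕ} (a : Fin m ↪o Fin n) : (rangeFinset a).card = m := by
  simp [rangeFinset]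

theorem rangeFinset_injective {m n : ℕ} :
    Function.Injective (rangeFinset : (Fin m ↪o Fin n) → Finset (Fin n)) := by
  intro a b h
  have key : ∀ c : Fin m ↪o Fin n, c = (rangeFinset c).orderEmbOfFin (card_rangeFinset c) :=
    fun c => Finset.orderEmbOfFin_unique' _ fun x => mem_rangeFinset.2 ⟨x, rfl⟩
  rw [key a, key b]
  congr 1

theorem card_orderEmbedding_fin (m n : ℕ) : Fintype.card (Fin m ↪o Fin n) = n.choose m := by
  rw [← Finset.card_univ, ← Finset.card_image_of_injective _ rangeFinset_injective]
  have : Finset.univ.image (rangeFinset : (Fin m ↪o Fin n) → Finset (Fin n)) =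
      Finset.univ.powersetCard m := by
    ext s
    simp only [Finset.mem_image, Finset.mem_univ, true_and, Finset.mem_powersetCard,
      Finset.subset_univ]
    refine ⟨?_, fun h => ⟨s.orderEmbOfFin h, ?_⟩⟩
    · rintro ⟨a, rfl⟩
      exact card_rangeFinset a
    · ext i
      rw [mem_rangeFinset, ← Finset.mem_coe, ← Finset.range_orderEmbOfFin s h, Set.mem_range]
  rw [this, Finset.card_powersetCard, Finset.card_univ, Fintype.card_fin]

/-- There are at most `n^r` choices for the union, and each of the two ranges is one of its `2^r`
subsets. -/
theorem card_filter_union_le (m n r : ℕ) :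
    (Finset.univ.filter fun z : (Fin m ↪o Fin n) × (Fin m ↪o Fin n) =>
      (rangeFinset z.1 ∪ rangeFinset z.2).card = r).card ≤ 4 ^ r * n ^ r := by
  have hinj : Set.InjOn (fun z : (Fin m ↪o Fin n) × (Fin m ↪o Fin n) =>
      (rangeFinset z.1, rangeFinset z.2)) Set.univ :=
    (rangeFinset_injective.prodMap rangeFinset_injective).injOn
  calc _ ≤ ((Finset.univ.powersetCard r).biUnion fun s : Finset (Fin n) =>
          s.powerset ×ˢ s.powerset).card := by
        refine Finset.card_le_card_of_injOn _ (fun z hz => ?_) (hinj.mono (Set.subset_univ _))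
        simp only [Finset.coe_filter, Finset.mem_univ, true_and, Set.mem_ofPred_eq] at hz
        simp only [Finset.coe_biUnion, Set.mem_iUnion, Finset.mem_coe, Finset.mem_product,
          Finset.mem_powerset, Finset.mem_powersetCard, Finset.subset_univ, true_and]
        exact ⟨_, hz, Finset.subset_union_left, Finset.subset_union_right⟩
    _ ≤ ∑ s ∈ Finset.univ.powersetCard r, (s.powerset ×ˢ s.powerset : Finset _).card :=
        Finset.card_biUnion_le
    _ = ∑ s ∈ (Finset.univ : Finset (Fin n)).powersetCard r, 4 ^ r := by
        refine Finset.sum_congr rfl fun s hs => ?_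
        rw [Finset.card_product, Finset.card_powerset, (Finset.mem_powersetCard.1 hs).2,
          ← mul_pow]
        rfl
    _ = n.choose r * 4 ^ r := by simp
    _ ≤ 4 ^ r * n ^ r := by
        rw [mul_comm]
        exact Nat.mul_le_mul_left _ (Nat.choose_le_pow _ _)

section

variable {Ω X ι : Type*} [MeasurableSpace Ω] [MeasurableSpace X] {μ : Measure Ω}
  {U : ι → Ω → X} {ν : Measure X}

theorem isProbabilityMeasure_of_map_eq [IsProbabilityMeasure μ] [Nonempty ι]
    (hU : ∀ i, Measurable (U i))
    (hν : ∀ i, μ.map (U i) = ν) : IsProbabilityMeasure ν :=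
  hν (Classical.arbitrary ι) ▸ Measure.isProbabilityMeasure_map (hU _).aemeasurable

theorem map_comp_eq_pi {κ : Type*} [Fintype κ] (hU : ∀ i, Measurable (U i))
    (hind : iIndepFun U μ) (hν : ∀ i, μ.map (U i) = ν) {a : κ → ι} (ha : Function.Injective a) :
    μ.map (fun ω j => U (a j) ω) = Measure.pi fun _ => ν := by
  rw [iIndepFun.map_fun_eq_pi_map (fun j => (hU (a j)).aemeasurable) (hind.precomp ha)]
  simp [hν]

/-- The probability that a point is in relation with each point of a family of other points. -/
theorem measure_forall_rel_le [IsProbabilityMeasure μ] (hU : ∀ i, Measurable (U i))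
    (hind : iIndepFun U μ)
    (hν : ∀ i, μ.map (U i) = ν) {R : Set (X × X)} (hR : MeasurableSet R) {q : ENNReal}
    (hq : ∀ u, ν {v | (u, v) ∈ R} ≤ q) {i : ι} {S : Finset ι} (hi : i ∉ S) :
    μ {ω | ∀ j ∈ S, (U i ω, U j ω) ∈ R} ≤ q ^ S.card := by
  classical
  have : Nonempty ι := ⟨i⟩
  have := isProbabilityMeasure_of_map_eq hU hν
  -- Given the value of `U i`, the remaining points are still independent with law `ν`, so Fubini
  -- factors the conditional probability.
  have hind2 : IndepFun (U i) (fun ω (j : S) => U j ω) μ := by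
    have h := hind.indepFun_finset {i} S (Finset.disjoint_singleton_left.2 hi) hU
    have hm : Measurable fun x : ({i} : Finset ι) → X => x ⟨i, Finset.mem_singleton_self i⟩ :=
      measurable_pi_apply _
    exact h.comp hm measurable_id
  have hY : Measurable fun ω (j : S) => U j ω := measurable_pi_lambda _ fun j => hU j
  have hmap := (indepFun_iff_map_prod_eq_prod_map_map (hU i).aemeasurable hY.aemeasurable).1 hind2
  rw [hν i, map_comp_eq_pi hU hind hν Subtype.val_injective] at hmap
  set B : Set (X × (S → X)) := {z | ∀ j, (z.1, z.2 j) ∈ R} with hB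
  have hBm : MeasurableSet B := by
    rw [hB, Set.ofPred_forall]
    refine MeasurableSet.iInter fun j => ?_
    exact (measurable_fst.prodMk ((measurable_pi_apply j).comp measurable_snd)) hR
  have h1 : {ω | ∀ j ∈ S, (U i ω, U j ω) ∈ R} = (fun ω => (U i ω, fun j : S => U j ω)) ⁻¹' B := by
    ext ω
    simp [hB]
  rw [h1, ← Measure.map_apply ((hU i).prodMk hY) hBm, hmap, Measure.prod_apply hBm]
  calc ∫⁻ u, (Measure.pi fun _ : S => ν) (Prod.mk u ⁻¹' B) ∂ν
      ≤ ∫⁻ _, q ^ S.card ∂ν := by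
        refine lintegral_mono fun u => ?_
        have h2 : Prod.mk u ⁻¹' B = Set.univ.pi fun _ => {v | (u, v) ∈ R} := by
          ext y; simp [hB]
        rw [h2, Measure.pi_pi]
        refine (Finset.prod_le_prod' fun _ _ => hq u).trans ?_
        simp
    _ = q ^ S.card := by simp

end

section

variable {Ω X : Type*} [MeasurableSpace Ω] [MeasurableSpace X] {μ : Measure Ω}
  [IsProbabilityMeasure μ] {m n : ℕ} {U : Fin n → Ω → X} {ν : Measure X}
  {G : Set (Fin m → X)} {R : Set (X × X)} {q : ℝ}

theorem measurable_tuple (hU : ∀ i, Measurable (U i)) (a : Fin m → Fin n) :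
    Measurable fun ω j => U (a j) ω :=
  measurable_pi_lambda _ fun j => hU (a j)

/-- A point common to both tuples is in relation with every other point of the union. This keeps the
full exponent `card - 1`, although points from different tuples need not be related to each other.
-/
theorem measureReal_tuple_inter_le (hU : ∀ i, Measurable (U i)) (hind : iIndepFun U μ)
    (hν : ∀ i, μ.map (U i) = ν) (hR : MeasurableSet R) (hq0 : 0 ≤ q)
    (hq : ∀ u, ν {v | (u, v) ∈ R} ≤ ENNReal.ofReal q) (hGR : ∀ u ∈ G, ∀ i j, (u i, u j) ∈ R)
    {a b : Fin m ↪o Fin n} (hab : ¬ Disjoint (rangeFinset a) (rangeFinset b)) :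
    μ.real ({ω | (fun j => U (a j) ω) ∈ G} ∩ {ω | (fun j => U (b j) ω) ∈ G}) ≤
      q ^ ((rangeFinset a ∪ rangeFinset b).card - 1) := by
  obtain ⟨i, hia, hib⟩ := Finset.not_disjoint_iff.1 hab
  obtain ⟨ja, rfl⟩ := mem_rangeFinset.1 hia
  obtain ⟨jb, hjb⟩ := mem_rangeFinset.1 hib
  have h := measure_forall_rel_le hU hind hν hR hq
    (Finset.notMem_erase (a ja) (rangeFinset a ∪ rangeFinset b))
  rw [Finset.card_erase_of_mem (Finset.mem_union_left _ hia), ← ENNReal.ofReal_pow hq0] at h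
  refine ENNReal.toReal_le_of_le_ofReal (by positivity) ((measure_mono ?_).trans h)
  rintro ω ⟨ha, hb⟩ j hj
  rcases Finset.mem_union.1 (Finset.mem_of_mem_erase hj) with hj | hj
  · obtain ⟨j', rfl⟩ := mem_rangeFinset.1 hj
    exact hGR _ ha ja j'
  · obtain ⟨j', rfl⟩ := mem_rangeFinset.1 hj
    have := hGR _ hb jb j'
    simpa only [hjb] using this

/-- Poisson approximation for the number of increasing `m`-tuples of independent points that lie
in a set `G` of tuples all of whose points are in a relation `R` of small probability. -/
theorem abs_measureReal_forall_notMem_sub_exp_le (hm : 0 < m) (hU : ∀ i, Measurable (U i))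
    (hind : iIndepFun U μ) (hν : ∀ i, μ.map (U i) = ν) (hG : MeasurableSet G)
    (hR : MeasurableSet R) (hq0 : 0 ≤ q) (hq : ∀ u, ν {v | (u, v) ∈ R} ≤ ENNReal.ofReal q)
    (hGR : ∀ u ∈ G, ∀ i j, (u i, u j) ∈ R) :
    |μ.real {ω | ∀ a : Fin m ↪o Fin n, (fun j => U (a j) ω) ∉ G} -
        Real.exp (-(n.choose m * (Measure.pi fun _ : Fin m => ν).real G))| ≤
      (∑ r ∈ Finset.range (2 * m), 4 ^ r * (n : ℝ) ^ r) *
          (Measure.pi fun _ : Fin m => ν).real G ^ 2 +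
        ∑ r ∈ Finset.Ioo m (2 * m), 4 ^ r * (n : ℝ) ^ r * q ^ (r - 1) := by
  classical
  set A : (Fin m ↪o Fin n) → Set Ω := fun a => {ω | (fun j => U (a j) ω) ∈ G} with hA
  have hAm : ∀ a, MeasurableSet (A a) := fun a => measurable_tuple hU a hG
  have hAp : ∀ a, μ.real (A a) = (Measure.pi fun _ : Fin m => ν).real G := fun a => by
    rw [← map_comp_eq_pi hU hind hν a.injective, map_measureReal_apply (measurable_tuple hU a) hG]
    rfl
  -- Tuples are neighbours when they share an index; the others depend only on points outside
  -- `rangeFinset a`, whence the independence.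
  set N : (Fin m ↪o Fin n) → Finset (Fin m ↪o Fin n) := fun a =>
    Finset.univ.filter fun b => ¬ Disjoint (rangeFinset a) (rangeFinset b) with hN
  have hself : ∀ a, a ∈ N a := fun a => by
    simp only [hN, Finset.mem_filter, Finset.mem_univ, true_and, disjoint_self,
      Finset.bot_eq_empty, ← Finset.card_eq_zero, card_rangeFinset]
    omega
  have hindN : ∀ a, IndepFun ((A a).indicator (1 : Ω → ℕ))
      (fun ω => ∑ b ∈ (N a)ᶜ, (A b).indicator (1 : Ω → ℕ) ω) μ := by
    intro a
    have h := hind.indepFun_finset (rangeFinset a) (rangeFinset a)ᶜ disjoint_compl_right hU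
    have hGi : Measurable (G.indicator (1 : (Fin m → X) → ℕ)) := measurable_const.indicator hG
    have hmem : ∀ j, a j ∈ rangeFinset a := fun j => mem_rangeFinset.2 ⟨j, rfl⟩
    have hmem' : ∀ b : {b // b ∈ (N a)ᶜ}, ∀ j, b.1 j ∈ (rangeFinset a)ᶜ := by
      intro b j
      have hb := b.2
      simp only [hN, Finset.compl_filter, not_not, Finset.mem_filter, Finset.mem_univ,
        true_and] at hb
      rw [Finset.mem_compl]
      exact fun hc => Finset.disjoint_left.1 hb hc (mem_rangeFinset.2 ⟨j, rfl⟩)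
    have hf : Measurable fun x : rangeFinset a → X =>
        G.indicator (1 : (Fin m → X) → ℕ) fun j => x ⟨a j, hmem j⟩ :=
      hGi.comp (measurable_pi_lambda _ fun j => measurable_pi_apply _)
    have hg : Measurable fun x : ((rangeFinset a)ᶜ : Finset (Fin n)) → X =>
        ∑ b ∈ (N a)ᶜ.attach, G.indicator (1 : (Fin m → X) → ℕ) fun j => x ⟨b.1 j, hmem' b j⟩ :=
      Finset.measurable_fun_sum _ fun b _ =>
        hGi.comp (measurable_pi_lambda _ fun j => measurable_pi_apply _)
    have h2 := h.comp hf hg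
    convert! h2 using 1
    ext ω
    rw [← Finset.sum_attach]
    rfl
  have hmain := abs_measureReal_compl_iUnion_sub_exp_le μ A hAm N hself hindN
  have hset : (⋃ a, A a)ᶜ = {ω | ∀ a : Fin m ↪o Fin n, (fun j => U (a j) ω) ∉ G} := by
    ext ω; simp [hA]
  simp_rw [hset, hAp] at hmain
  rw [Finset.sum_const, Finset.card_univ, card_orderEmbedding_fin, nsmul_eq_mul] at hmain
  set P := (Measure.pi fun _ : Fin m => ν).real G with hP
  have hcard : ∀ r, (((Finset.univ.filter fun z : (Fin m ↪o Fin n) × (Fin m ↪o Fin n) =>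
      (rangeFinset z.1 ∪ rangeFinset z.2).card = r).card : ℕ) : ℝ) ≤ 4 ^ r * (n : ℝ) ^ r :=
    fun r => by exact_mod_cast card_filter_union_le m n r
  have hlt : ∀ a, ∀ b ∈ N a, (rangeFinset a ∪ rangeFinset b).card < 2 * m := by
    intro a b hb
    have h1 := Finset.card_union_add_card_inter (rangeFinset a) (rangeFinset b)
    rw [card_rangeFinset, card_rangeFinset] at h1
    have h2 : 0 < (rangeFinset a ∩ rangeFinset b).card := by
      simp only [hN, Finset.mem_filter, Finset.mem_univ, true_and] at hb
      rw [Finset.card_pos]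
      exact Finset.not_disjoint_iff_nonempty_inter.1 hb
    omega
  have hgt : ∀ a, ∀ b ∈ (N a).erase a, m < (rangeFinset a ∪ rangeFinset b).card := by
    intro a b hb
    by_contra! hc
    have h1 : rangeFinset a = rangeFinset a ∪ rangeFinset b :=
      Finset.eq_of_subset_of_card_le Finset.subset_union_left (by rwa [card_rangeFinset])
    have h2 : rangeFinset b = rangeFinset a ∪ rangeFinset b :=
      Finset.eq_of_subset_of_card_le Finset.subset_union_right (by rwa [card_rangeFinset])
    exact (Finset.ne_of_mem_erase hb) (rangeFinset_injective (h2.trans h1.symm))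
  -- Pairs are grouped by the size `r` of their union. Sharing an index gives `r < 2 * m`, and
  -- distinctness gives `r > m`.
  have hsum : ∀ (T : (Fin m ↪o Fin n) → Finset (Fin m ↪o Fin n)) (Q : Finset ℕ) (w : ℕ → ℝ),
      (∀ r, 0 ≤ w r) → (∀ a, ∀ b ∈ T a, (rangeFinset a ∪ rangeFinset b).card ∈ Q) →
      ∑ a, ∑ b ∈ T a, w (rangeFinset a ∪ rangeFinset b).card ≤
        ∑ r ∈ Q, 4 ^ r * (n : ℝ) ^ r * w r := by
    intro T Q w hw hT
    have e1 : ∑ a, ∑ b ∈ T a, w (rangeFinset a ∪ rangeFinset b).card =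
        ∑ z ∈ Finset.univ.filter fun z : (Fin m ↪o Fin n) × (Fin m ↪o Fin n) => z.2 ∈ T z.1,
          w (rangeFinset z.1 ∪ rangeFinset z.2).card := by
      rw [Finset.sum_filter, Fintype.sum_prod_type]
      refine Finset.sum_congr rfl fun a _ => ?_
      rw [← Finset.sum_filter]
      simp
    rw [e1, ← Finset.sum_fiberwise_of_maps_to (t := Q)
      (g := fun z : (Fin m ↪o Fin n) × (Fin m ↪o Fin n) => (rangeFinset z.1 ∪ rangeFinset z.2).card)
      (fun z hz => hT _ _ (Finset.mem_filter.1 hz).2)]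
    refine Finset.sum_le_sum fun r _ => ?_
    rw [Finset.sum_congr rfl fun z hz => by rw [(Finset.mem_filter.1 hz).2],
      Finset.sum_const, nsmul_eq_mul]
    refine mul_le_mul_of_nonneg_right (le_trans ?_ (hcard r)) (hw r)
    exact_mod_cast Finset.card_le_card
      (Finset.filter_subset_filter _ (Finset.subset_univ _))
  refine hmain.trans (add_le_add ?_ ?_)
  · refine (hsum N (Finset.range (2 * m)) (fun _ => P * P) (fun _ => by positivity)
      fun a b hb => Finset.mem_range.2 (hlt a b hb)).trans (le_of_eq ?_)
    rw [Finset.sum_mul, sq]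
  · refine le_trans (Finset.sum_le_sum fun a _ => Finset.sum_le_sum fun b hb => ?_)
      (hsum (fun a => (N a).erase a) (Finset.Ioo m (2 * m)) (fun r => q ^ (r - 1))
        (fun _ => by positivity)
        fun a b hb => Finset.mem_Ioo.2 ⟨hgt a b hb, hlt a b (Finset.mem_of_mem_erase hb)⟩)
    refine measureReal_tuple_inter_le hU hind hν hR hq0 hq hGR ?_
    have := Finset.mem_of_mem_erase hb
    simpa only [hN, Finset.mem_filter, Finset.mem_univ, true_and] using this

end

/-! ### The volume of an ellipsoid -/

/-- The increments of a tuple, the last one being from the last entry to `0`. -/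
def closedIncrement {m : ℕ} (c : Fin m → ℝ) (i : Fin m) : ℝ :=
  (if h : (i : ℕ) + 1 < m then c ⟨i + 1, h⟩ else 0) - c i

/-- The matrix of partial sums. -/
def partialSumMatrix (k : ℕ) : Matrix (Fin k) (Fin k) ℝ :=
  Matrix.of fun i j => if j ≤ i then 1 else 0

theorem det_partialSumMatrix (k : ℕ) : (partialSumMatrix k).det = 1 := by
  rw [Matrix.det_of_isLowerTriangular]
  · simp [partialSumMatrix]
  · intro i j hij
    have : i < j := hij
    simp [partialSumMatrix, this]

theorem cons_partialSumMatrix {k : ℕ} (d : Fin k → ℝ) (j : Fin (k + 1)) :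
    (Fin.cons 0 ((partialSumMatrix k).mulVec d) : Fin (k + 1) → ℝ) j =
      ∑ i : Fin k, if i.castSucc < j then d i else 0 := by
  refine Fin.cases ?_ (fun j => ?_) j
  · simp
  · simp only [Fin.cons_succ, Matrix.mulVec, dotProduct, partialSumMatrix, Matrix.of_apply,
      ite_mul, one_mul, zero_mul, Fin.castSucc_lt_succ_iff]

/-- In the coordinates `d` of successive increments, the closed increments are the entries of `d`
and `-∑ d`, since they sum to zero. -/
theorem sum_sq_closedIncrement {k : ℕ} (d : Fin k → ℝ) :
    ∑ i, closedIncrement (Fin.cons 0 ((partialSumMatrix k).mulVec d) : Fin (k + 1) → ℝ) i ^ 2 =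
      ∑ i, d i ^ 2 + (∑ i, d i) ^ 2 := by
  rw [Fin.sum_univ_castSucc]
  congr 1
  · refine Finset.sum_congr rfl fun i _ => ?_
    have hi : (i.castSucc : ℕ) + 1 < k + 1 := by simp
    have hsucc : (⟨(i.castSucc : ℕ) + 1, hi⟩ : Fin (k + 1)) = i.succ := by ext; simp
    rw [closedIncrement, dif_pos hi, hsucc, cons_partialSumMatrix, cons_partialSumMatrix,
      ← Finset.sum_sub_distrib, Finset.sum_eq_single i]
    · simp
    · intro j _ hj
      rcases lt_or_gt_of_ne hj with h | h
      · simp [h, h.le]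
      · simp [h.not_ge, h.not_gt]
    · simp
  · rw [closedIncrement, dif_neg (by simp), cons_partialSumMatrix]
    simp [Fin.castSucc_lt_last]

/-- A square root of the matrix `1 + J`, where all entries of `J` are `1`. -/
def sqrtOneAddOnes (k : ℕ) : Matrix (Fin k) (Fin k) ℝ :=
  1 + Matrix.replicateCol Unit (fun _ : Fin k => (√(k + 1 : ℝ) - 1) / k) *
    Matrix.replicateRow Unit (fun _ : Fin k => (1 : ℝ))

theorem det_sqrtOneAddOnes {k : ℕ} (hk : k ≠ 0) : (sqrtOneAddOnes k).det = √(k + 1 : ℝ) := by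
  have hk' : (k : ℝ) ≠ 0 := by exact_mod_cast hk
  rw [sqrtOneAddOnes, Matrix.det_one_add_replicateCol_mul_replicateRow]
  simp [dotProduct]
  field_simp
  ring

theorem sum_sq_sqrtOneAddOnes {k : ℕ} (hk : k ≠ 0) (d : Fin k → ℝ) :
    ∑ i, (sqrtOneAddOnes k).mulVec d i ^ 2 = ∑ i, d i ^ 2 + (∑ i, d i) ^ 2 := by
  have hk' : (k : ℝ) ≠ 0 := by exact_mod_cast hk
  set c := (√(k + 1 : ℝ) - 1) / k with hc
  have hck : (1 + c * k) ^ 2 = k + 1 := by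
    have : 1 + c * k = √(k + 1 : ℝ) := by rw [hc]; field_simp; ring
    rw [this, Real.sq_sqrt (by positivity)]
  -- This is the condition for `(1 + c J)² = 1 + J`, as `J² = k J`.
  have hc2 : 2 * c + k * c ^ 2 = 1 := by
    have : (k : ℝ) * (2 * c + k * c ^ 2) = k * 1 := by linear_combination hck
    exact mul_left_cancel₀ hk' this
  have hT : ∀ i, (sqrtOneAddOnes k).mulVec d i = d i + c * ∑ j, d j := by
    intro i
    rw [sqrtOneAddOnes, Matrix.add_mulVec, Matrix.one_mulVec, Pi.add_apply]
    simp only [Matrix.mulVec, dotProduct, Matrix.mul_apply, Matrix.replicateCol_apply,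
      Matrix.replicateRow_apply, Finset.univ_unique, Finset.sum_const, Finset.card_singleton,
      one_smul, mul_one, Finset.mul_sum, ← hc]
  set s := ∑ j, d j with hs
  have : ∀ i, (d i + c * s) ^ 2 = d i ^ 2 + 2 * c * s * d i + c ^ 2 * s ^ 2 := fun i => by ring
  simp_rw [hT, this, Finset.sum_add_distrib, ← Finset.mul_sum, ← hs]
  simp only [Finset.sum_const, Finset.card_univ, Fintype.card_fin, nsmul_eq_mul]
  linear_combination s ^ 2 * hc2

/-- Both sets pull back to the same set of `d`, one under a map of determinant `1`, the other under
one of determinant `√(k + 1)`. A general `A` covers both the solid ellipsoid and its boundary. -/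
theorem volume_sum_sq_closedIncrement_mem {k : ℕ} (hk : k ≠ 0) (A : Set ℝ) :
    volume {z : Fin k → ℝ | ∑ i, closedIncrement (Fin.cons 0 z : Fin (k + 1) → ℝ) i ^ 2 ∈ A} =
      ENNReal.ofReal (√(k + 1 : ℝ))⁻¹ * volume {z : Fin k → ℝ | ∑ i, z i ^ 2 ∈ A} := by
  have hpos : 0 < √(k + 1 : ℝ) := Real.sqrt_pos.2 (by positivity)
  have h1 := Measure.addHaar_preimage_linearMap (volume : Measure (Fin k → ℝ))
    (f := Matrix.toLin' (partialSumMatrix k)) (by simp [det_partialSumMatrix])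
    {z : Fin k → ℝ | ∑ i, closedIncrement (Fin.cons 0 z : Fin (k + 1) → ℝ) i ^ 2 ∈ A}
  have h2 := Measure.addHaar_preimage_linearMap (volume : Measure (Fin k → ℝ))
    (f := Matrix.toLin' (sqrtOneAddOnes k)) (by
      rw [LinearMap.det_toLin', det_sqrtOneAddOnes hk]; exact hpos.ne')
    {z : Fin k → ℝ | ∑ i, z i ^ 2 ∈ A}
  rw [LinearMap.det_toLin', det_partialSumMatrix, inv_one, abs_one, ENNReal.ofReal_one,
    one_mul] at h1
  rw [LinearMap.det_toLin', det_sqrtOneAddOnes hk, abs_of_pos (inv_pos.2 hpos)] at h2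
  rw [← h1, ← h2]
  congr 1
  ext d
  simp only [Set.mem_preimage, Set.mem_ofPred_eq, Matrix.toLin'_apply, sum_sq_closedIncrement,
    sum_sq_sqrtOneAddOnes hk]

theorem volume_sum_sq_le {k : ℕ} (hk : k ≠ 0) {R : ℝ} (hR : 0 ≤ R) :
    volume {z : Fin k → ℝ | ∑ i, z i ^ 2 ≤ R ^ 2} =
      ENNReal.ofReal (R ^ k * (√π ^ k / Real.Gamma (k / 2 + 1))) := by
  have : Nonempty (Fin k) := ⟨⟨0, Nat.pos_of_ne_zero hk⟩⟩
  have h := EuclideanSpace.volume_closedBall (ι := Fin k) 0 R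
  rw [Fintype.card_fin, ← ENNReal.ofReal_pow hR, ← ENNReal.ofReal_mul (by positivity),
    ← (PiLp.volume_preserving_toLp (Fin k)).measure_preimage_equiv
      (f := MeasurableEquiv.toLp 2 (Fin k → ℝ))] at h
  rw [← h]
  congr 1
  ext z
  rw [Set.mem_preimage, mem_closedBall_zero_iff, Set.mem_ofPred_eq]
  rw [← sq_le_sq₀ (norm_nonneg _) hR, EuclideanSpace.norm_sq_eq]
  simp

theorem volume_sum_sq_eq {k : ℕ} (hk : k ≠ 0) {R : ℝ} (hR : 0 ≤ R) :
    volume {z : Fin k → ℝ | ∑ i, z i ^ 2 = R ^ 2} = 0 := by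
  have : Nonempty (Fin k) := ⟨⟨0, Nat.pos_of_ne_zero hk⟩⟩
  have h := Measure.addHaar_sphere (volume : Measure (EuclideanSpace ℝ (Fin k))) 0 R
  rw [← (PiLp.volume_preserving_toLp (Fin k)).measure_preimage_equiv
      (f := MeasurableEquiv.toLp 2 (Fin k → ℝ))] at h
  rw [← h]
  congr 1
  ext z
  rw [Set.mem_preimage, mem_sphere_zero_iff_norm, Set.mem_ofPred_eq]
  rw [← sq_eq_sq₀ (norm_nonneg _) hR, EuclideanSpace.norm_sq_eq]
  simp

/-! ### The law of the angles of a tuple -/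

theorem setLIntegral_Ico_add_eq {F : ℝ → ENNReal} {T : ℝ} (hT : 0 < T)
    (hF : Function.Periodic F T) (a : ℝ) :
    ∫⁻ y in Set.Ico 0 T, F (a + y) = ∫⁻ x in Set.Ico 0 T, F x := by
  have h0 := (isAddFundamentalDomain_Ioc hT a).setLIntegral_eq
    (isAddFundamentalDomain_Ioc hT 0) F (by
      rintro ⟨_, n, rfl⟩ x
      change F (n • T + x) = F x
      rw [add_comm]
      exact hF.zsmul n x)
  have h1 := (measurePreserving_add_left volume a).setLIntegral_comp_preimage_emb
    (measurableEmbedding_addLeft a) F (Set.Ico a (a + T))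
  have h2 : (fun y => a + y) ⁻¹' Set.Ico a (a + T) = Set.Ico 0 T := by
    ext y; simp
  rw [h2] at h1
  rw [h1, restrict_Ico_eq_restrict_Ioc, h0, zero_add, restrict_Ico_eq_restrict_Ioc]

/-- Angles measured from `exp a` are polar angles shifted by `a`, and periodicity moves the window
of integration back to `[0, 2π)`. -/
theorem map_centralAngle_circleLaw {p : ℝ → ℝ}
    (hper : Function.Periodic p (2 * π)) (a : ℝ) :
    (circleLaw p).map (centralAngle (Circle.exp a)) =
      (volume.restrict (Set.Ico 0 (2 * π))).withDensity fun y => ENNReal.ofReal (p (a + y)) := by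
  have hcm : Measurable (centralAngle (Circle.exp a)) :=
    measurable_centralAngle.comp measurable_prodMk_left
  have hem : Measurable Circle.exp := Circle.exp.continuous.measurable
  ext s hs
  have hpre : MeasurableSet (Circle.exp ⁻¹' (centralAngle (Circle.exp a) ⁻¹' s)) := hem (hcm hs)
  rw [Measure.map_apply hcm hs, circleLaw, Measure.map_apply hem (hcm hs),
    withDensity_apply _ hpre, withDensity_apply _ hs, ← lintegral_indicator hpre,
    ← lintegral_indicator hs]
  set F : ℝ → ENNReal := (Circle.exp ⁻¹' (centralAngle (Circle.exp a) ⁻¹' s)).indicator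
    fun x => ENNReal.ofReal (p x) with hF
  have hFapp : ∀ x, F x = s.indicator (fun _ => ENNReal.ofReal (p x))
      (centralAngle (Circle.exp a) (Circle.exp x)) := fun x => rfl
  have hFper : Function.Periodic F (2 * π) := fun x => by
    rw [hFapp, hFapp, Circle.exp_add, Circle.exp_two_pi, mul_one, hper x]
  rw [← setLIntegral_Ico_add_eq Real.two_pi_pos hFper a]
  refine setLIntegral_congr_fun measurableSet_Ico fun y hy => ?_
  change F (a + y) = s.indicator (fun y => ENNReal.ofReal (p (a + y))) y
  rw [hFapp, centralAngle_exp_add a hy]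
  rfl

theorem pi_withDensity_ofReal {ι : Type*} [Fintype ι] {f : ℝ → ℝ} (hf0 : ∀ x, 0 ≤ f x)
    (hf : Integrable f) :
    Measure.pi (fun _ : ι => (volume : Measure ℝ).withDensity fun x => ENNReal.ofReal (f x)) =
      (volume : Measure (ι → ℝ)).withDensity fun y => ENNReal.ofReal (∏ i, f (y i)) := by
  have hfin : IsFiniteMeasure ((volume : Measure ℝ).withDensity fun x => ENNReal.ofReal (f x)) :=
    isFiniteMeasure_withDensity_ofReal hf.2
  refine Measure.pi_eq fun s hs => ?_
  have hind : ∀ y : ι → ℝ, (Set.univ.pi s).indicator (fun y => ENNReal.ofReal (∏ i, f (y i))) y =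
      ENNReal.ofReal (∏ i, (s i).indicator f (y i)) := by
    intro y
    by_cases hy : y ∈ Set.univ.pi s
    · rw [Set.indicator_of_mem hy]
      congr 1
      exact Finset.prod_congr rfl fun i _ => (Set.indicator_of_mem (hy i (Set.mem_univ i)) f).symm
    · rw [Set.indicator_of_notMem hy]
      simp only [Set.mem_pi, Set.mem_univ, forall_const, not_forall] at hy
      obtain ⟨i, hi⟩ := hy
      rw [Finset.prod_eq_zero (Finset.mem_univ i) (Set.indicator_of_notMem hi f),
        ENNReal.ofReal_zero]
  have hnn : ∀ i x, 0 ≤ (s i).indicator f x := fun i x =>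
    Set.indicator_nonneg (fun x _ => hf0 x) x
  rw [withDensity_apply _ (MeasurableSet.univ_pi hs), ← lintegral_indicator (.univ_pi hs),
    lintegral_congr hind, volume_pi, ← ofReal_integral_eq_lintegral_ofReal
      (Integrable.fintype_prod fun i => hf.indicator (hs i))
      (ae_of_all _ fun y => Finset.prod_nonneg fun i _ => hnn i _),
    integral_fintype_prod_eq_prod fun i => (s i).indicator f,
    ENNReal.ofReal_prod_of_nonneg fun i _ => integral_nonneg (hnn i)]
  refine Finset.prod_congr rfl fun i _ => ?_
  rw [withDensity_apply _ (hs i), ofReal_integral_eq_lintegral_ofReal (hf.indicator (hs i))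
    (ae_of_all _ (hnn i)), ← lintegral_indicator (hs i)]
  congr 1
  ext x
  by_cases hx : x ∈ s i <;> simp [hx]

/-! ### Symmetrization -/

theorem volume_setOf_apply_eq_apply {ι : Type*} [Fintype ι] {i j : ι} (hij : i ≠ j) :
    volume {y : ι → ℝ | y i = y j} = 0 := by
  classical
  have h : {y : ι → ℝ | y i = y j} = (LinearMap.ker
      ((LinearMap.proj i : (ι → ℝ) →ₗ[ℝ] ℝ) - LinearMap.proj j) : Submodule ℝ (ι → ℝ)) := by
    ext y; simp [sub_eq_zero]
  rw [h]
  refine Measure.addHaar_submodule _ _ fun htop => ?_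
  have : Pi.single i (1 : ℝ) ∈ LinearMap.ker
      ((LinearMap.proj i : (ι → ℝ) →ₗ[ℝ] ℝ) - LinearMap.proj j) := htop ▸ Submodule.mem_top
  simp [hij.symm] at this

theorem measurableSet_strictMono (k : ℕ) : MeasurableSet {y : Fin k → ℝ | StrictMono y} := by
  simp only [StrictMono, Set.ofPred_forall]
  refine MeasurableSet.iInter fun i => .iInter fun j => .iInter fun _ => ?_
  exact measurableSet_lt (measurable_pi_apply i) (measurable_pi_apply j)

/-- The integral of a symmetric function is `k!` times its integral over increasing tuples. -/
theorem lintegral_eq_factorial_mul_setLIntegral_strictMono {k : ℕ} {F : (Fin k → ℝ) → ENNReal}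
    (hFsymm : ∀ y (σ : Equiv.Perm (Fin k)), F (y ∘ σ) = F y) :
    ∫⁻ y, F y = k.factorial * ∫⁻ y in {y | StrictMono y}, F y := by
  -- The `k!` orderings of the coordinates give disjoint regions that miss only the null hyperplanes
  -- `y i = y j`, and symmetry equates the integrals over them.
  set T : Equiv.Perm (Fin k) → Set (Fin k → ℝ) := fun σ => {y | StrictMono (y ∘ σ)} with hT
  have hTm : ∀ σ, MeasurableSet (T σ) := fun σ =>
    (measurable_pi_lambda (fun (y : Fin k → ℝ) i => y (σ i)) fun i => measurable_pi_apply (σ i))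
      (measurableSet_strictMono k)
  have hdisj : Pairwise (Function.onFun Disjoint T) := by
    intro σ τ hστ
    refine Set.disjoint_left.2 fun y h1 h2 => hστ ?_
    have hy : Function.Injective y := by
      have := (StrictMono.injective h1).comp σ.symm.injective
      simpa [Function.comp_assoc] using this
    have h3 : y ∘ σ = y ∘ τ :=
      Tuple.unique_monotone (StrictMono.monotone h1) (StrictMono.monotone h2)
    ext i
    exact congrArg _ (hy (congrFun h3 i))
  have hcover : volume (⋃ σ, T σ)ᶜ = 0 := by
    refine measure_mono_null (t := ⋃ i : Fin k, ⋃ j : Fin k, ⋃ _ : i ≠ j, {y | y i = y j}) ?_ ?_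
    · intro y hy
      by_contra hc
      simp only [Set.mem_iUnion, not_exists] at hc
      refine hy (Set.mem_iUnion.2 ⟨Tuple.sort y, ?_⟩)
      refine (Tuple.monotone_sort y).strictMono_of_injective
        (Function.Injective.comp (fun i j h => ?_) (Equiv.injective _))
      by_contra hij
      exact hc i j hij h
    · exact measure_iUnion_null fun i => measure_iUnion_null fun j => measure_iUnion_null fun hij =>
        volume_setOf_apply_eq_apply hij
  have hterm : ∀ σ, ∫⁻ y in T σ, F y = ∫⁻ y in {y | StrictMono y}, F y := by
    intro σ
    have h := volume_measurePreserving_piCongrLeft (fun _ : Fin k => ℝ) σ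
    have h2 := h.setLIntegral_comp_preimage_emb (MeasurableEquiv.measurableEmbedding _) F (T σ)
    rw [← h2]
    have hcomp : ∀ y : Fin k → ℝ, (MeasurableEquiv.piCongrLeft (fun _ : Fin k => ℝ) σ) y =
        y ∘ σ.symm := fun y => by
      ext i
      obtain ⟨j, rfl⟩ := σ.surjective i
      rw [MeasurableEquiv.coe_piCongrLeft, Equiv.piCongrLeft_apply_apply]
      simp
    have h3 : (MeasurableEquiv.piCongrLeft (fun _ : Fin k => ℝ) σ) ⁻¹' T σ =
        {y | StrictMono y} := by
      ext y
      simp only [hT, Set.mem_preimage, Set.mem_ofPred_eq, hcomp, Function.comp_assoc,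
        Equiv.symm_comp_self, Function.comp_id]
    rw [h3]
    exact lintegral_congr fun y => by rw [hcomp, hFsymm]
  calc ∫⁻ y, F y = ∫⁻ y in ⋃ σ, T σ, F y := by
        rw [Measure.restrict_eq_self_of_ae_mem]
        exact mem_ae_iff.2 hcover
    _ = ∑ σ, ∫⁻ y in T σ, F y := by
        rw [lintegral_iUnion hTm hdisj, tsum_fintype]
    _ = k.factorial * ∫⁻ y in {y | StrictMono y}, F y := by
        simp_rw [hterm]
        rw [Finset.sum_const, Finset.card_univ, Fintype.card_perm, Fintype.card_fin, nsmul_eq_mul]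

/-! ### Reduction of the kernel to the angles -/

/-- A permutation of the last `k` angles extends to one of all `k + 1` fixing the initial `0`, so
the symmetry of `angleSet` passes to the remaining angles. -/
theorem cons_comp_perm {k : ℕ} (y : Fin k → ℝ) (σ : Equiv.Perm (Fin k)) :
    (Fin.cons 0 (y ∘ σ) : Fin (k + 1) → ℝ) =
      (Fin.cons 0 y : Fin (k + 1) → ℝ) ∘ Equiv.Perm.decomposeFin.symm (0, σ) := by
  ext j
  refine Fin.cases ?_ (fun j => ?_) j
  · simp
  · simp

theorem measurable_cons_zero (k : ℕ) :
    Measurable fun y : Fin k → ℝ => (Fin.cons 0 y : Fin (k + 1) → ℝ) := by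
  refine measurable_pi_lambda _ fun j => ?_
  refine Fin.cases ?_ (fun j => ?_) j
  · simp
  · simpa using measurable_pi_apply j

/-- The difference between `m * g (2π / m)` and the sum of the values of `g` at the sorted gaps. -/
def angleDeficit (g : ℝ → ℝ) {m : ℕ} (b : Fin m → ℝ) : ℝ :=
  m * g (2 * π / m) - ∑ i, g (sortedGap b i)

theorem sub_arcKernel_eq {m : ℕ} [NeZero m] (g : ℝ → ℝ) (u : Fin m → Circle) :
    m * g (2 * π / m) - arcKernel g u = angleDeficit g fun j => centralAngle (u 0) (u j) := rfl

/-- The tuples of angles in `[0, 2π)` with deficit at most `s`. -/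
def angleSet (g : ℝ → ℝ) (m : ℕ) (s : ℝ) : Set (Fin m → ℝ) :=
  {b | (∀ j, b j ∈ Set.Ico 0 (2 * π)) ∧ angleDeficit g b ≤ s}

theorem measurableSet_angleSet {g : ℝ → ℝ} (hg : ContinuousOn g (Set.Icc 0 (2 * π))) (m : ℕ)
    (s : ℝ) : MeasurableSet (angleSet g m s) := by
  -- Nothing is known of `g` outside `[0, 2π]`; a continuous extension has the same values at all
  -- gaps.
  set g' : ℝ → ℝ := Set.IccExtend Real.two_pi_pos.le ((Set.Icc 0 (2 * π)).domRestrict g) with hg'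
  have hg'm : Measurable g' := (hg.domRestrict.Icc_extend' (h := Real.two_pi_pos.le)).measurable
  have heq : ∀ x ∈ Set.Icc 0 (2 * π), g' x = g x := fun x hx => by
    rw [hg', Set.IccExtend_of_mem _ _ hx]; rfl
  have hset : angleSet g m s = {b | ∀ j, b j ∈ Set.Ico 0 (2 * π)} ∩
      {b | m * g (2 * π / m) - ∑ i, g' (sortedGap b i) ≤ s} := by
    ext b
    refine and_congr_right fun hb => ?_
    have : ∀ i, g' (sortedGap b i) = g (sortedGap b i) := fun i => heq _ (sortedGap_mem_Icc hb i)
    simp only [Set.mem_ofPred_eq, this, angleDeficit]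
  rw [hset]
  refine MeasurableSet.inter ?_ ?_
  · rw [Set.ofPred_forall]
    exact MeasurableSet.iInter fun j => measurable_pi_apply j measurableSet_Ico
  · exact measurableSet_le (measurable_const.sub (Finset.measurable_fun_sum _ fun i _ =>
      hg'm.comp (measurable_sortedGap i))) measurable_const

theorem comp_perm_mem_angleSet {g : ℝ → ℝ} {m : ℕ} {s : ℝ} (b : Fin m → ℝ)
    (σ : Equiv.Perm (Fin m)) : b ∘ σ ∈ angleSet g m s ↔ b ∈ angleSet g m s := by
  unfold angleSet angleDeficit
  simp only [Set.mem_ofPred_eq, sortedGap_comp_perm, Function.comp]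
  rw [σ.forall_congr_right (q := fun j => b j ∈ Set.Ico 0 (2 * π))]

theorem setOf_sub_arcKernel_le {m : ℕ} [NeZero m] (g : ℝ → ℝ) (s : ℝ) :
    {u : Fin m → Circle | m * g (2 * π / m) - arcKernel g u ≤ s} =
      {u | (fun j => centralAngle (u 0) (u j)) ∈ angleSet g m s} := by
  ext u
  simp only [sub_arcKernel_eq, angleSet, Set.mem_ofPred_eq, centralAngle_mem, forall_const,
    true_and]

theorem measurable_centralAngle_tuple {m : ℕ} [NeZero m] :
    Measurable fun (u : Fin m → Circle) j => centralAngle (u 0) (u j) :=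
  measurable_pi_lambda _ fun j => by
    have h : Measurable fun u : Fin m → Circle => (u 0, u j) :=
      (measurable_pi_apply 0).prodMk (measurable_pi_apply j)
    exact measurable_centralAngle.comp h

theorem lintegral_circleLaw {p : ℝ → ℝ} (hp : Measurable p) {F : Circle → ENNReal}
    (hF : Measurable F) :
    ∫⁻ u, F u ∂circleLaw p =
      ∫⁻ a in Set.Ico 0 (2 * π), ENNReal.ofReal (p a) * F (Circle.exp a) := by
  have hem : Measurable Circle.exp := Circle.exp.continuous.measurable
  have hFe : Measurable fun a => F (Circle.exp a) := hF.comp hem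
  rw [circleLaw, lintegral_map hF hem,
    lintegral_withDensity_eq_lintegral_mul _ (by fun_prop) hFe]
  rfl

theorem pi_fin_succ_apply {X : Type*} [MeasurableSpace X] {k : ℕ} (ν : Measure X) [SigmaFinite ν]
    {C : Set (Fin (k + 1) → X)} (hC : MeasurableSet C) :
    (Measure.pi fun _ : Fin (k + 1) => ν) C =
      ∫⁻ u, (Measure.pi fun _ : Fin k => ν) {v | (Fin.cons u v : Fin (k + 1) → X) ∈ C} ∂ν := by
  have hmp := (measurePreserving_piFinSuccAbove (fun _ : Fin (k + 1) => ν) 0).symm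
  rw [← hmp.measure_preimage_equiv, Measure.prod_apply (MeasurableEquiv.measurable _ hC)]
  refine lintegral_congr fun u => ?_
  congr 1
  ext v
  have h1 : (MeasurableEquiv.piFinSuccAbove (fun _ : Fin (k + 1) => X) 0).symm (u, v) =
      Fin.cons u v := by
    simp [MeasurableEquiv.piFinSuccAbove, Fin.insertNthEquiv]
  rw [Set.mem_preimage, Set.mem_preimage, h1]
  rfl

section

variable {X : Type*} [MeasurableSpace X] {k : ℕ} (ν : Measure X) [IsProbabilityMeasure ν]
  {h : X → X → ℝ} {B : Set (Fin (k + 1) → ℝ)}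

theorem measurable_pi_map_cons_zero_mem (hh : Measurable fun z : X × X => h z.1 z.2)
    (hB : MeasurableSet B) : Measurable fun u : X =>
      (Measure.pi fun _ : Fin k => ν)
        {v | (Fin.cons 0 (fun j => h u (v j)) : Fin (k + 1) → ℝ) ∈ B} := by
  have hBm : MeasurableSet {y : Fin k → ℝ | (Fin.cons 0 y : Fin (k + 1) → ℝ) ∈ B} :=
    measurable_cons_zero k hB
  have hm2 : Measurable fun z : X × (Fin k → X) => fun j => h z.1 (z.2 j) := by
    refine measurable_pi_lambda _ fun j => ?_
    have hm3 : Measurable fun z : X × (Fin k → X) => (z.1, z.2 j) :=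
      measurable_fst.prodMk ((measurable_pi_apply j).comp measurable_snd)
    exact hh.comp hm3
  exact measurable_measure_prodMk_left (hm2 hBm)

theorem pi_map_apply_cons_zero_mem (hh : Measurable fun z : X × X => h z.1 z.2)
    (hB : MeasurableSet B) (u : X) :
    (Measure.pi fun _ : Fin k => ν) {v | (Fin.cons 0 (fun j => h u (v j)) : Fin (k + 1) → ℝ) ∈ B} =
      (Measure.pi fun _ : Fin k => ν.map (h u)) {y | (Fin.cons 0 y : Fin (k + 1) → ℝ) ∈ B} := by
  have hBm : MeasurableSet {y : Fin k → ℝ | (Fin.cons 0 y : Fin (k + 1) → ℝ) ∈ B} :=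
    measurable_cons_zero k hB
  have hcm : Measurable (h u) := hh.comp measurable_prodMk_left
  have hprob : IsProbabilityMeasure (ν.map (h u)) :=
    Measure.isProbabilityMeasure_map hcm.aemeasurable
  have hcm' : Measurable fun (v : Fin k → X) j => h u (v j) :=
    measurable_pi_lambda _ fun j => hcm.comp (measurable_pi_apply j)
  rw [← Measure.pi_map_pi (μ := fun _ : Fin k => ν) (f := fun _ => h u) fun _ => hcm.aemeasurable,
    Measure.map_apply hcm' hBm]
  rfl

theorem pi_apply_setOf_zero_mem (hh : Measurable fun z : X × X => h z.1 z.2)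
    (h0 : ∀ u, h u u = 0) (hB : MeasurableSet B) :
    (Measure.pi fun _ : Fin (k + 1) => ν) {u | (fun j => h (u 0) (u j)) ∈ B} =
      ∫⁻ u, (Measure.pi fun _ : Fin k => ν)
        {v | (Fin.cons 0 (fun j => h u (v j)) : Fin (k + 1) → ℝ) ∈ B} ∂ν := by
  have hm : Measurable fun (u : Fin (k + 1) → X) j => h (u 0) (u j) := by
    refine measurable_pi_lambda _ fun j => ?_
    have hm3 : Measurable fun u : Fin (k + 1) → X => (u 0, u j) :=
      (measurable_pi_apply 0).prodMk (measurable_pi_apply j)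
    exact hh.comp hm3
  refine (pi_fin_succ_apply ν (hm hB)).trans (lintegral_congr fun u => ?_)
  congr 1
  ext v
  have hv : (fun j => h ((Fin.cons u v : Fin (k + 1) → X) 0) ((Fin.cons u v : Fin (k + 1) → X) j)) =
      (Fin.cons 0 (fun j => h u (v j)) : Fin (k + 1) → ℝ) := by
    ext j
    refine Fin.cases ?_ (fun j => ?_) j
    · simp [h0]
    · simp
  rw [Set.mem_ofPred_eq, Set.mem_preimage, Set.mem_ofPred_eq, hv]

end

theorem pi_circleLaw_centralAngle_mem {k : ℕ} {p : ℝ → ℝ} [IsProbabilityMeasure (circleLaw p)]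
    (hp : Measurable p) (hper : Function.Periodic p (2 * π)) {B : Set (Fin (k + 1) → ℝ)}
    (hB : MeasurableSet B) :
    (Measure.pi fun _ : Fin (k + 1) => circleLaw p)
        {u | (fun j => centralAngle (u 0) (u j)) ∈ B} =
      ∫⁻ a in Set.Ico 0 (2 * π), ENNReal.ofReal (p a) *
        (Measure.pi fun _ : Fin k => (volume.restrict (Set.Ico 0 (2 * π))).withDensity
          fun y => ENNReal.ofReal (p (a + y))) {y | (Fin.cons 0 y : Fin (k + 1) → ℝ) ∈ B} := by
  rw [pi_apply_setOf_zero_mem _ measurable_centralAngle centralAngle_self hB,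
    lintegral_circleLaw hp (measurable_pi_map_cons_zero_mem _ measurable_centralAngle hB)]
  refine lintegral_congr fun a => ?_
  rw [pi_map_apply_cons_zero_mem _ measurable_centralAngle hB, map_centralAngle_circleLaw hper]

/-- The probability of a small deficit, as an integral over increasing tuples of angles. -/
theorem pi_circleLaw_angleSet {k : ℕ} {p : ℝ → ℝ} [IsProbabilityMeasure (circleLaw p)]
    (hp : Continuous p) (hp0 : ∀ x, 0 ≤ p x) (hper : Function.Periodic p (2 * π)) {g : ℝ → ℝ}
    (hg : ContinuousOn g (Set.Icc 0 (2 * π))) (s : ℝ) :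
    (Measure.pi fun _ : Fin (k + 1) => circleLaw p)
        {u | ((k + 1 : ℕ) : ℝ) * g (2 * π / (k + 1 : ℕ)) - arcKernel g u ≤ s} =
      ∫⁻ a in Set.Ico 0 (2 * π), ENNReal.ofReal (p a) * (k.factorial *
        ∫⁻ y, {y : Fin k → ℝ | StrictMono y ∧ (Fin.cons 0 y : Fin (k + 1) → ℝ) ∈
          angleSet g (k + 1) s}.indicator (fun y => ENNReal.ofReal (∏ j, p (a + y j))) y) := by
  have hB := measurableSet_angleSet hg (k + 1) s
  rw [setOf_sub_arcKernel_le, pi_circleLaw_centralAngle_mem hp.measurable hper hB]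
  refine lintegral_congr fun a => ?_
  congr 1
  set S : Set (Fin k → ℝ) := {y | (Fin.cons 0 y : Fin (k + 1) → ℝ) ∈ angleSet g (k + 1) s} with hS
  have hSm : MeasurableSet S := measurable_cons_zero k hB
  set f : ℝ → ℝ := (Set.Ico 0 (2 * π)).indicator fun y => p (a + y) with hf
  have hf0 : ∀ x, 0 ≤ f x := fun x => Set.indicator_nonneg (fun x _ => hp0 _) x
  have hfint : Integrable f := by
    rw [hf, integrable_indicator_iff measurableSet_Ico]
    have h1 : Continuous fun y => p (a + y) := by fun_prop
    exact (h1.integrableOn_Icc (a := 0) (b := 2 * π)).mono_set Set.Ico_subset_Icc_self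
  have hdens : (volume.restrict (Set.Ico 0 (2 * π))).withDensity
      (fun y => ENNReal.ofReal (p (a + y))) =
      (volume : Measure ℝ).withDensity fun y => ENNReal.ofReal (f y) := by
    rw [← withDensity_indicator measurableSet_Ico]
    congr 1
    ext x
    by_cases hx : x ∈ Set.Ico 0 (2 * π)
    · simp only [hf, Set.indicator_of_mem hx]
    · simp only [hf, Set.indicator_of_notMem hx, ENNReal.ofReal_zero]
  rw [hdens, pi_withDensity_ofReal hf0 hfint, withDensity_apply _ hSm,
    ← lintegral_indicator hSm, lintegral_eq_factorial_mul_setLIntegral_strictMono,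
    ← lintegral_indicator (measurableSet_strictMono k)]
  · congr 1
    refine lintegral_congr fun y => ?_
    have hset : {y : Fin k → ℝ | StrictMono y ∧ (Fin.cons 0 y : Fin (k + 1) → ℝ) ∈
        angleSet g (k + 1) s} = {y | StrictMono y} ∩ S := rfl
    rw [hset, ← Set.indicator_indicator]
    by_cases h1 : y ∈ {y : Fin k → ℝ | StrictMono y}
    · rw [Set.indicator_of_mem h1, Set.indicator_of_mem h1]
      by_cases h2 : y ∈ S
      · rw [Set.indicator_of_mem h2, Set.indicator_of_mem h2]
        congr 1
        refine Finset.prod_congr rfl fun j _ => ?_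
        have h3 : (Fin.cons 0 y : Fin (k + 1) → ℝ) ∈ angleSet g (k + 1) s := h2
        have h4 := h3.1 j.succ
        rw [Fin.cons_succ] at h4
        rw [hf, Set.indicator_of_mem h4]
      · rw [Set.indicator_of_notMem h2, Set.indicator_of_notMem h2]
    · rw [Set.indicator_of_notMem h1, Set.indicator_of_notMem h1]
  · intro y σ
    have h1 : y ∘ σ ∈ S ↔ y ∈ S := by
      simp only [hS, Set.mem_ofPred_eq, cons_comp_perm, comp_perm_mem_angleSet]
    have h2 : ∏ i, f ((y ∘ σ) i) = ∏ i, f (y i) := Equiv.prod_comp σ fun i => f (y i)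
    by_cases h : y ∈ S
    · rw [Set.indicator_of_mem h, Set.indicator_of_mem (h1.2 h), h2]
    · rw [Set.indicator_of_notMem h, Set.indicator_of_notMem (mt h1.1 h)]

/-! ### Local analysis near the regular polygon -/

/-- The deficit is a sum of nonnegative tangent gaps, so each of them, and with it `c` times the
squared deviation, is at most `e ^ 2`. -/
theorem abs_sortedGap_sub_le {g : ℝ → ℝ} {m : ℕ} [NeZero m] {c : ℝ} (hc : 0 < c)
    (hgc : ∀ d, 2 * π / m + d ∈ Set.Icc 0 (2 * π) → c * d ^ 2 ≤ tangentGap g (2 * π / m) d)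
    {e : ℝ} (he : 0 ≤ e) {b : Fin m → ℝ} (hb : b ∈ angleSet g m (e ^ 2)) (hb0 : b 0 = 0)
    (i : Fin m) : |sortedGap b i - 2 * π / m| ≤ e / √c := by
  have h1 := hb.2
  rw [angleDeficit, sub_sum_sortedGap_eq (fun j => (hb.1 j).1) hb0] at h1
  have hterm : ∀ i, c * (sortedGap b i - 2 * π / m) ^ 2 ≤
      tangentGap g (2 * π / m) (sortedGap b i - 2 * π / m) := fun i =>
    hgc _ (by rw [add_sub_cancel]; exact sortedGap_mem_Icc hb.1 i)
  have h2 : c * (sortedGap b i - 2 * π / m) ^ 2 ≤ e ^ 2 :=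
    (hterm i).trans ((Finset.single_le_sum (fun j _ => (by positivity : (0 : ℝ) ≤
      c * (sortedGap b j - 2 * π / m) ^ 2).trans (hterm j)) (Finset.mem_univ i)).trans h1)
  refine abs_le_of_sq_le_sq ?_ (by positivity)
  rw [div_pow, Real.sq_sqrt hc.le, le_div_iff₀ hc]
  linarith

/-- The angles of a regular polygon, except the first one, after a perturbation. -/
def perturbedAngle {k : ℕ} (e : ℝ) (z : Fin k → ℝ) (j : Fin k) : ℝ :=
  2 * π * (j + 1) / (k + 1 : ℕ) + e * z j

theorem cons_perturbedAngle {k : ℕ} (e : ℝ) (z : Fin k → ℝ) (j : Fin (k + 1)) :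
    (Fin.cons 0 (perturbedAngle e z) : Fin (k + 1) → ℝ) j =
      2 * π * j / (k + 1 : ℕ) + e * (Fin.cons 0 z : Fin (k + 1) → ℝ) j := by
  refine Fin.cases ?_ (fun j => ?_) j
  · simp
  · simp [perturbedAngle]

theorem monotone_cons_zero {k : ℕ} {y : Fin k → ℝ} (hy : Monotone y) (hy0 : ∀ j, 0 ≤ y j) :
    Monotone (Fin.cons 0 y : Fin (k + 1) → ℝ) := by
  intro i j hij
  revert hij
  refine Fin.cases ?_ (fun i => ?_) i <;> refine Fin.cases ?_ (fun j => ?_) j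
  · simp
  · simpa using hy0 j
  · intro h
    exact absurd h (by simp)
  · simpa using fun h => hy h

theorem sortedGap_cons_perturbedAngle {k : ℕ} {e : ℝ} {z : Fin k → ℝ}
    (hy : StrictMono (perturbedAngle e z)) (hy0 : ∀ j, 0 ≤ perturbedAngle e z j)
    (i : Fin (k + 1)) :
    sortedGap (Fin.cons 0 (perturbedAngle e z) : Fin (k + 1) → ℝ) i =
      2 * π / (k + 1 : ℕ) + e * closedIncrement (Fin.cons 0 z : Fin (k + 1) → ℝ) i := by
  rw [sortedGap_of_monotone (monotone_cons_zero hy.monotone hy0), closedIncrement]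
  have hk : ((k + 1 : ℕ) : ℝ) ≠ 0 := by positivity
  split_ifs with h
  · rw [cons_perturbedAngle, cons_perturbedAngle]
    push_cast
    ring
  -- The last gap ends at `2π`, an unperturbed vertex; hence the `0` in `closedIncrement`.
  · rw [cons_perturbedAngle]
    have hi : (i : ℕ) = k := by have := i.2; omega
    rw [hi]
    field_simp
    push_cast
    ring

/-- The rescaled increasing tuples of angles with small deficit. -/
def localSet (g : ℝ → ℝ) (k : ℕ) (e : ℝ) : Set (Fin k → ℝ) :=
  {z | StrictMono (perturbedAngle e z) ∧
    (Fin.cons 0 (perturbedAngle e z) : Fin (k + 1) → ℝ) ∈ angleSet g (k + 1) (e ^ 2)}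

/-- The bound does not depend on `e`: the rescaled sets stay in one box, which provides the
dominating function for the limit. -/
theorem abs_le_of_mem_localSet {g : ℝ → ℝ} {k : ℕ} {c : ℝ} (hc : 0 < c)
    (hgc : ∀ d, 2 * π / (k + 1 : ℕ) + d ∈ Set.Icc 0 (2 * π) →
      c * d ^ 2 ≤ tangentGap g (2 * π / (k + 1 : ℕ)) d)
    {e : ℝ} (he : 0 < e) {z : Fin k → ℝ} (hz : z ∈ localSet g k e) (j : Fin k) :
    |z j| ≤ (k + 1 : ℕ) / √c := by
  obtain ⟨h1, h2⟩ := hz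
  have hmono := monotone_cons_zero h1.monotone fun j => by simpa using (h2.1 j.succ).1
  have h3 := abs_sort_sub_le (fun j => (h2.1 j).1) (by simp)
    (abs_sortedGap_sub_le hc hgc he.le h2 (by simp)) j.succ
  rw [Tuple.sort_eq_refl_iff_monotone.2 hmono] at h3
  simp only [Equiv.coe_refl, Function.comp_id] at h3
  rw [cons_perturbedAngle, add_sub_cancel_left, Fin.cons_succ, abs_mul, abs_of_pos he] at h3
  have h4 : ((k + 1 : ℕ) : ℝ) * (e / √c) = e * ((k + 1 : ℕ) / √c) := by ring
  rw [h4] at h3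
  exact le_of_mul_le_mul_left h3 he

theorem tendsto_perturbedAngle {k : ℕ} (z : Fin k → ℝ) (j : Fin k) :
    Tendsto (fun e => perturbedAngle e z j) (𝓝[>] 0) (𝓝 (2 * π * (j + 1) / (k + 1 : ℕ))) := by
  have h : Continuous fun e => perturbedAngle e z j := by unfold perturbedAngle; fun_prop
  have h2 := h.tendsto 0
  simp only [perturbedAngle, zero_mul, add_zero] at h2
  exact h2.mono_left nhdsWithin_le_nhds

theorem eventually_strictMono_perturbedAngle {k : ℕ} (z : Fin k → ℝ) :
    ∀ᶠ e in 𝓝[>] 0, StrictMono (perturbedAngle e z) := by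
  have h : ∀ i j : Fin k, i < j → ∀ᶠ e in 𝓝[>] 0, perturbedAngle e z i < perturbedAngle e z j := by
    intro i j hij
    refine (tendsto_perturbedAngle z i).eventually_lt (tendsto_perturbedAngle z j) ?_
    have : (i : ℝ) < j := by exact_mod_cast hij
    have hk : (0 : ℝ) < (k + 1 : ℕ) := by positivity
    have := Real.pi_pos
    gcongr
  have h2 : ∀ᶠ e in 𝓝[>] 0, ∀ i j : Fin k, i < j → perturbedAngle e z i < perturbedAngle e z j := by
    simp only [eventually_all]
    exact h
  filter_upwards [h2] with e he i j hij using he i j hij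

theorem eventually_perturbedAngle_mem {k : ℕ} (z : Fin k → ℝ) :
    ∀ᶠ e in 𝓝[>] 0, ∀ j, perturbedAngle e z j ∈ Set.Ico 0 (2 * π) := by
  rw [eventually_all]
  intro j
  refine (tendsto_perturbedAngle z j).eventually (Ico_mem_nhds ?_ ?_)
  · have := Real.pi_pos
    positivity
  · have hk : (0 : ℝ) < (k + 1 : ℕ) := by positivity
    rw [div_lt_iff₀ hk]
    have : (j : ℝ) + 1 < (k + 1 : ℕ) := by exact_mod_cast Nat.succ_lt_succ j.2
    nlinarith [Real.pi_pos]

theorem tendsto_angleDeficit_div_sq {g : ℝ → ℝ} {k : ℕ}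
    (hg : ContDiffAt ℝ 2 g (2 * π / (k + 1 : ℕ))) (z : Fin k → ℝ) :
    Tendsto (fun e => angleDeficit g (Fin.cons 0 (perturbedAngle e z) : Fin (k + 1) → ℝ) / e ^ 2)
      (𝓝[>] 0) (𝓝 (-iteratedDeriv 2 g (2 * π / (k + 1 : ℕ)) / 2 *
        ∑ i, closedIncrement (Fin.cons 0 z : Fin (k + 1) → ℝ) i ^ 2)) := by
  have h1 := tendsto_finsetSum Finset.univ fun (i : Fin (k + 1)) _ =>
    tendsto_tangentGap_mul_div_sq hg (closedIncrement (Fin.cons 0 z : Fin (k + 1) → ℝ) i)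
  rw [← Finset.mul_sum] at h1
  refine h1.congr' ?_
  filter_upwards [eventually_strictMono_perturbedAngle z, eventually_perturbedAngle_mem z]
    with e he1 he2
  have hnn : ∀ j, 0 ≤ (Fin.cons 0 (perturbedAngle e z) : Fin (k + 1) → ℝ) j := fun j => by
    refine Fin.cases ?_ (fun j => ?_) j
    · simp
    · simpa using (he2 j).1
  rw [angleDeficit, sub_sum_sortedGap_eq hnn (by simp), ← Finset.sum_div]
  congr 1
  refine Finset.sum_congr rfl fun i _ => ?_
  rw [sortedGap_cons_perturbedAngle he1 fun j => (he2 j).1, add_sub_cancel_left]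

/-- Order and range constraints hold for all small `e`, so membership is decided by the rescaled
deficit, whose limit is not the threshold `1`. -/
theorem eventually_mem_localSet_iff {g : ℝ → ℝ} {k : ℕ}
    (hg : ContDiffAt ℝ 2 g (2 * π / (k + 1 : ℕ))) {z : Fin k → ℝ}
    (hz : -iteratedDeriv 2 g (2 * π / (k + 1 : ℕ)) / 2 *
        ∑ i, closedIncrement (Fin.cons 0 z : Fin (k + 1) → ℝ) i ^ 2 ≠ 1) :
    ∀ᶠ e in 𝓝[>] 0, (z ∈ localSet g k e ↔ -iteratedDeriv 2 g (2 * π / (k + 1 : ℕ)) / 2 *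
        ∑ i, closedIncrement (Fin.cons 0 z : Fin (k + 1) → ℝ) i ^ 2 ≤ 1) := by
  have hlim := tendsto_angleDeficit_div_sq hg z
  have hiff : ∀ᶠ e in 𝓝[>] 0, (z ∈ localSet g k e ↔
      angleDeficit g (Fin.cons 0 (perturbedAngle e z) : Fin (k + 1) → ℝ) / e ^ 2 ≤ 1) := by
    filter_upwards [eventually_strictMono_perturbedAngle z, eventually_perturbedAngle_mem z,
      self_mem_nhdsWithin] with e he1 he2 he
    have he : 0 < e := he
    have h3 : ∀ j, (Fin.cons 0 (perturbedAngle e z) : Fin (k + 1) → ℝ) j ∈ Set.Ico 0 (2 * π) := by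
      intro j
      refine Fin.cases ?_ (fun j => ?_) j
      · simp [Real.pi_pos]
      · simpa using he2 j
    rw [div_le_one (by positivity)]
    exact ⟨fun h => h.2.2, fun h => ⟨he1, h3, h⟩⟩
  rcases lt_or_gt_of_ne hz with h | h
  · filter_upwards [hiff, hlim.eventually_lt_const h] with e h1 h2
    rw [h1]
    exact ⟨fun _ => h.le, fun _ => h2.le⟩
  · filter_upwards [hiff, hlim.eventually_const_lt h] with e h1 h2
    rw [h1]
    exact ⟨fun h' => absurd h' h2.not_ge, fun h' => absurd h' h.not_ge⟩

theorem measurable_perturbedAngle {k : ℕ} (e : ℝ) :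
    Measurable (perturbedAngle e : (Fin k → ℝ) → Fin k → ℝ) :=
  measurable_pi_lambda _ fun j => by unfold perturbedAngle; fun_prop

theorem measurableSet_localSet {g : ℝ → ℝ} (hg : ContinuousOn g (Set.Icc 0 (2 * π))) (k : ℕ)
    (e : ℝ) : MeasurableSet (localSet g k e) :=
  (measurable_perturbedAngle e (measurableSet_strictMono k)).inter
    (measurable_perturbedAngle e (measurable_cons_zero k (measurableSet_angleSet hg _ _)))

theorem lintegral_eq_lintegral_perturbedAngle {k : ℕ} {F : (Fin k → ℝ) → ENNReal}
    (hF : Measurable F) {e : ℝ} (he : 0 < e) :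
    ∫⁻ y, F y = ENNReal.ofReal (e ^ k) * ∫⁻ z, F (perturbedAngle e z) := by
  set c : Fin k → ℝ := fun j => 2 * π * (j + 1) / (k + 1 : ℕ) with hc
  have h1 : ∀ z : Fin k → ℝ, perturbedAngle e z = c + e • z := fun z => by
    ext j; simp [perturbedAngle, hc]
  have h2 : ∫⁻ z : Fin k → ℝ, F (c + e • z) = ENNReal.ofReal |(e ^ k)⁻¹| * ∫⁻ y, F (c + y) := by
    have hm : Measurable fun y => F (c + y) := hF.comp (measurable_const_add c)
    have h3 := Measure.map_addHaar_smul (volume : Measure (Fin k → ℝ)) he.ne'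
    rw [Module.finrank_fin_fun] at h3
    rw [← lintegral_map (g := fun z : Fin k → ℝ => e • z) hm (measurable_const_smul e), h3,
      lintegral_smul_measure, smul_eq_mul]
  simp_rw [h1]
  rw [h2, lintegral_add_left_eq_self F c, ← mul_assoc, ← ENNReal.ofReal_mul (by positivity),
    abs_of_pos (by positivity), mul_inv_cancel₀ (by positivity), ENNReal.ofReal_one, one_mul]

/-! ### The probability of a small deficit -/

/-- The limiting quadratic form of the deficit. -/
def deficitForm (g : ℝ → ℝ) {k : ℕ} (z : Fin k → ℝ) : ℝ :=
  -iteratedDeriv 2 g (2 * π / (k + 1 : ℕ)) / 2 *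
    ∑ i, closedIncrement (Fin.cons 0 z : Fin (k + 1) → ℝ) i ^ 2

theorem volume_deficitForm_le {g : ℝ → ℝ} {k : ℕ} (hk : k ≠ 0)
    (hneg : iteratedDeriv 2 g (2 * π / (k + 1 : ℕ)) < 0) :
    volume {z : Fin k → ℝ | deficitForm g z ≤ 1} = ENNReal.ofReal ((√(k + 1 : ℝ))⁻¹ *
      ((√(2 / -iteratedDeriv 2 g (2 * π / (k + 1 : ℕ)))) ^ k *
        (√π ^ k / Real.Gamma (k / 2 + 1)))) := by
  set D := iteratedDeriv 2 g (2 * π / (k + 1 : ℕ)) with hD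
  have hR : 0 < 2 / -D := div_pos two_pos (neg_pos.2 hneg)
  have h := volume_sum_sq_closedIncrement_mem hk (Set.Iic (√(2 / -D) ^ 2))
  simp only [Set.mem_Iic] at h
  rw [volume_sum_sq_le hk (Real.sqrt_nonneg _), ← ENNReal.ofReal_mul (by positivity)] at h
  rw [← h]
  congr 1
  ext z
  rw [Set.mem_ofPred_eq, Set.mem_ofPred_eq, Real.sq_sqrt hR.le, le_div_iff₀ (neg_pos.2 hneg),
    deficitForm, ← hD]
  constructor <;> intro h <;> linarith

theorem volume_deficitForm_eq {g : ℝ → ℝ} {k : ℕ} (hk : k ≠ 0)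
    (hneg : iteratedDeriv 2 g (2 * π / (k + 1 : ℕ)) < 0) :
    volume {z : Fin k → ℝ | deficitForm g z = 1} = 0 := by
  set D := iteratedDeriv 2 g (2 * π / (k + 1 : ℕ)) with hD
  have hR : 0 < 2 / -D := div_pos two_pos (neg_pos.2 hneg)
  have h := volume_sum_sq_closedIncrement_mem hk {√(2 / -D) ^ 2}
  simp only [Set.mem_singleton_iff] at h
  rw [volume_sum_sq_eq hk (Real.sqrt_nonneg _), mul_zero] at h
  rw [← h]
  congr 1
  ext z
  rw [Set.mem_ofPred_eq, Set.mem_ofPred_eq, Real.sq_sqrt hR.le, eq_div_iff (neg_pos.2 hneg).ne',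
    deficitForm, ← hD]
  constructor <;> intro h <;> linarith

section

variable {k : ℕ} {p g : ℝ → ℝ}

/-- The rescaled inner integral in the probability of a small deficit. -/
def localIntegral (p g : ℝ → ℝ) (k : ℕ) (a e : ℝ) : ENNReal :=
  ∫⁻ z, (localSet g k e).indicator
    (fun z => ENNReal.ofReal (∏ j, p (a + perturbedAngle e z j))) z

theorem measurable_localIntegral (hp : Continuous p) (hg : ContinuousOn g (Set.Icc 0 (2 * π)))
    (e : ℝ) : Measurable fun a => localIntegral p g k a e := by
  have h1 : Measurable fun x : ℝ × (Fin k → ℝ) => (Prod.snd ⁻¹' localSet g k e).indicator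
      (fun x : ℝ × (Fin k → ℝ) => ENNReal.ofReal (∏ j, p (x.1 + perturbedAngle e x.2 j))) x := by
    refine Measurable.indicator ?_ (measurable_snd (measurableSet_localSet hg k e))
    refine ENNReal.measurable_ofReal.comp (Continuous.measurable ?_)
    unfold perturbedAngle
    fun_prop
  exact h1.lintegral_prod_right'

theorem localIntegral_integrand_le {M : ℝ} (hp0 : ∀ x, 0 ≤ p x) (hM : ∀ x, p x ≤ M) {B : ℝ}
    {e : ℝ} (hB : ∀ z ∈ localSet g k e, ∀ j, |z j| ≤ B) (a : ℝ) (z : Fin k → ℝ) :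
    (localSet g k e).indicator (fun z => ENNReal.ofReal (∏ j, p (a + perturbedAngle e z j))) z ≤
      (Set.Icc (fun _ : Fin k => -B) (fun _ => B)).indicator
        (fun _ => ENNReal.ofReal (M ^ k)) z := by
  by_cases hz : z ∈ localSet g k e
  · have hz2 : z ∈ Set.Icc (fun _ : Fin k => -B) (fun _ => B) :=
      ⟨fun j => (abs_le.1 (hB z hz j)).1, fun j => (abs_le.1 (hB z hz j)).2⟩
    rw [Set.indicator_of_mem hz, Set.indicator_of_mem hz2]
    refine ENNReal.ofReal_le_ofReal ?_
    calc ∏ j, p (a + perturbedAngle e z j) ≤ ∏ _j : Fin k, M :=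
          Finset.prod_le_prod (fun _ _ => hp0 _) fun _ _ => hM _
      _ = M ^ k := by simp
  · rw [Set.indicator_of_notMem hz]
    exact zero_le

theorem lintegral_indicator_Icc_ne_top (B : ℝ) (C : ℝ) :
    ∫⁻ z, (Set.Icc (fun _ : Fin k => -B) (fun _ => B)).indicator (fun _ => ENNReal.ofReal C) z ≠
      ⊤ := by
  rw [lintegral_indicator measurableSet_Icc, setLIntegral_const]
  exact ENNReal.mul_ne_top ENNReal.ofReal_ne_top isCompact_Icc.measure_lt_top.ne

/-- Dominated convergence: the integrands are at most `M ^ k` on a fixed box and converge off the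
boundary of the limiting ellipsoid, which is null. -/
theorem tendsto_localIntegral
    (hp : Continuous p) (hp0 : ∀ x, 0 ≤ p x) {M : ℝ} (hM : ∀ x, p x ≤ M)
    (hg : ContinuousOn g (Set.Icc 0 (2 * π))) (hg2 : ContDiffAt ℝ 2 g (2 * π / (k + 1 : ℕ)))
    (hneg : iteratedDeriv 2 g (2 * π / (k + 1 : ℕ)) < 0) {c : ℝ} (hc : 0 < c)
    (hgc : ∀ d, 2 * π / (k + 1 : ℕ) + d ∈ Set.Icc 0 (2 * π) →
      c * d ^ 2 ≤ tangentGap g (2 * π / (k + 1 : ℕ)) d)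
    (hk : k ≠ 0) (a : ℝ) :
    Tendsto (localIntegral p g k a) (𝓝[>] 0)
      (𝓝 (ENNReal.ofReal (∏ j : Fin k, p (a + 2 * π * (j + 1) / (k + 1 : ℕ))) *
        volume {z : Fin k → ℝ | deficitForm g z ≤ 1})) := by
  have hQm : MeasurableSet {z : Fin k → ℝ | deficitForm g z ≤ 1} := by
    refine measurableSet_le ?_ measurable_const
    unfold deficitForm
    refine (Finset.measurable_fun_sum _ fun i _ => ?_).const_mul _
    have h : ∀ j, Measurable fun z : Fin k → ℝ => (Fin.cons 0 z : Fin (k + 1) → ℝ) j :=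
      fun j => (measurable_pi_apply j).comp (measurable_cons_zero k)
    unfold closedIncrement
    split_ifs with hi
    · exact ((h _).sub (h _)).pow_const 2
    · exact (measurable_const.sub (h _)).pow_const 2
  rw [← setLIntegral_const, ← lintegral_indicator hQm]
  refine tendsto_lintegral_filter_of_dominated_convergence
    ((Set.Icc (fun _ : Fin k => -((k + 1 : ℕ) / √c)) (fun _ => (k + 1 : ℕ) / √c)).indicator
      fun _ => ENNReal.ofReal (M ^ k)) ?_ ?_ (lintegral_indicator_Icc_ne_top _ _) ?_
  · refine Eventually.of_forall fun e => Measurable.indicator ?_ (measurableSet_localSet hg k e)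
    refine ENNReal.measurable_ofReal.comp (Continuous.measurable ?_)
    unfold perturbedAngle
    fun_prop
  · filter_upwards [self_mem_nhdsWithin] with e he
    exact ae_of_all _ fun z => localIntegral_integrand_le hp0 hM
      (fun z hz => abs_le_of_mem_localSet hc hgc he hz) a z
  · have hae : ∀ᵐ z : Fin k → ℝ, deficitForm g z ≠ 1 := by
      rw [ae_iff]
      simpa using volume_deficitForm_eq hk hneg
    filter_upwards [hae] with z hz
    have hev := eventually_mem_localSet_iff hg2 hz
    have hlim : Tendsto (fun e => ENNReal.ofReal (∏ j, p (a + perturbedAngle e z j))) (𝓝[>] 0)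
        (𝓝 (ENNReal.ofReal (∏ j : Fin k, p (a + 2 * π * (j + 1) / (k + 1 : ℕ))))) := by
      refine ENNReal.tendsto_ofReal (tendsto_finsetProd _ fun j _ => ?_)
      exact (hp.tendsto _).comp ((tendsto_perturbedAngle z j).const_add a)
    by_cases h1 : deficitForm g z ≤ 1
    · have h1' : z ∈ {z : Fin k → ℝ | deficitForm g z ≤ 1} := h1
      rw [Set.indicator_of_mem h1']
      refine hlim.congr' ?_
      filter_upwards [hev] with e he
      rw [Set.indicator_of_mem (he.2 h1)]
    · have h1' : z ∉ {z : Fin k → ℝ | deficitForm g z ≤ 1} := h1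
      rw [Set.indicator_of_notMem h1']
      refine tendsto_const_nhds.congr' ?_
      filter_upwards [hev] with e he
      rw [Set.indicator_of_notMem (mt he.1 h1)]

theorem tendsto_lintegral_localIntegral
    (hp : Continuous p) (hp0 : ∀ x, 0 ≤ p x) {M : ℝ} (hM : ∀ x, p x ≤ M)
    (hg : ContinuousOn g (Set.Icc 0 (2 * π))) (hg2 : ContDiffAt ℝ 2 g (2 * π / (k + 1 : ℕ)))
    (hneg : iteratedDeriv 2 g (2 * π / (k + 1 : ℕ)) < 0) {c : ℝ} (hc : 0 < c)
    (hgc : ∀ d, 2 * π / (k + 1 : ℕ) + d ∈ Set.Icc 0 (2 * π) →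
      c * d ^ 2 ≤ tangentGap g (2 * π / (k + 1 : ℕ)) d)
    (hk : k ≠ 0) :
    Tendsto (fun e => ∫⁻ a in Set.Ico 0 (2 * π), ENNReal.ofReal (p a) * localIntegral p g k a e)
      (𝓝[>] 0) (𝓝 (∫⁻ a in Set.Ico 0 (2 * π), ENNReal.ofReal (p a) *
        (ENNReal.ofReal (∏ j : Fin k, p (a + 2 * π * (j + 1) / (k + 1 : ℕ))) *
          volume {z : Fin k → ℝ | deficitForm g z ≤ 1}))) := by
  refine tendsto_lintegral_filter_of_dominated_convergence
    (fun _ => ENNReal.ofReal M * ∫⁻ z, (Set.Icc (fun _ : Fin k => -((k + 1 : ℕ) / √c))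
      (fun _ => (k + 1 : ℕ) / √c)).indicator (fun _ => ENNReal.ofReal (M ^ k)) z) ?_ ?_ ?_ ?_
  · exact Eventually.of_forall fun e => (ENNReal.measurable_ofReal.comp hp.measurable).mul
      (measurable_localIntegral hp hg e)
  · filter_upwards [self_mem_nhdsWithin] with e he
    refine ae_of_all _ fun a => mul_le_mul' (ENNReal.ofReal_le_ofReal (hM a)) ?_
    exact lintegral_mono fun z => localIntegral_integrand_le hp0 hM
      (fun z hz => abs_le_of_mem_localSet hc hgc he hz) a z
  · rw [setLIntegral_const]
    refine ENNReal.mul_ne_top (ENNReal.mul_ne_top ENNReal.ofReal_ne_top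
      (lintegral_indicator_Icc_ne_top _ _)) ?_
    rw [Real.volume_Ico]
    exact ENNReal.ofReal_ne_top
  · exact ae_of_all _ fun a => ENNReal.Tendsto.const_mul
      (tendsto_localIntegral hp hp0 hM hg hg2 hneg hc hgc hk a) (Or.inr ENNReal.ofReal_ne_top)

theorem pi_circleLaw_eq_localIntegral [IsProbabilityMeasure (circleLaw p)]
    (hp : Continuous p) (hp0 : ∀ x, 0 ≤ p x) (hg : ContinuousOn g (Set.Icc 0 (2 * π)))
    (hper : Function.Periodic p (2 * π)) {e : ℝ} (he : 0 < e) :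
    (Measure.pi fun _ : Fin (k + 1) => circleLaw p)
        {u | ((k + 1 : ℕ) : ℝ) * g (2 * π / (k + 1 : ℕ)) - arcKernel g u ≤ e ^ 2} =
      ENNReal.ofReal (k.factorial * e ^ k) *
        ∫⁻ a in Set.Ico 0 (2 * π), ENNReal.ofReal (p a) * localIntegral p g k a e := by
  have hmeas : Measurable fun a => ENNReal.ofReal (p a) * localIntegral p g k a e :=
    (ENNReal.measurable_ofReal.comp hp.measurable).mul (measurable_localIntegral hp hg e)
  rw [pi_circleLaw_angleSet hp hp0 hper hg, ← lintegral_const_mul _ hmeas]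
  refine lintegral_congr fun a => ?_
  have hm : Measurable ({y : Fin k → ℝ | StrictMono y ∧ (Fin.cons 0 y : Fin (k + 1) → ℝ) ∈
      angleSet g (k + 1) (e ^ 2)}.indicator fun y => ENNReal.ofReal (∏ j, p (a + y j))) := by
    refine Measurable.indicator ?_ ((measurableSet_strictMono k).inter
      (measurable_cons_zero k (measurableSet_angleSet hg _ _)))
    exact ENNReal.measurable_ofReal.comp (Continuous.measurable (by fun_prop))
  rw [lintegral_eq_lintegral_perturbedAngle hm he, ENNReal.ofReal_mul (Nat.cast_nonneg _),
    ENNReal.ofReal_natCast]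
  have hloc : localIntegral p g k a e = ∫⁻ z, ({y : Fin k → ℝ | StrictMono y ∧
      (Fin.cons 0 y : Fin (k + 1) → ℝ) ∈ angleSet g (k + 1) (e ^ 2)}.indicator
        fun y => ENNReal.ofReal (∏ j, p (a + y j))) (perturbedAngle e z) := rfl
  rw [hloc]
  ring

end

/-- The volume of the region where the limiting quadratic form of the deficit is at most `1`. -/
def deficitVolume (g : ℝ → ℝ) (k : ℕ) : ℝ :=
  (√(k + 1 : ℝ))⁻¹ * ((√(2 / -iteratedDeriv 2 g (2 * π / (k + 1 : ℕ)))) ^ k *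
    (√π ^ k / Real.Gamma (k / 2 + 1)))

theorem deficitVolume_nonneg (g : ℝ → ℝ) (k : ℕ) : 0 ≤ deficitVolume g k := by
  have : 0 < Real.Gamma (k / 2 + 1 : ℝ) := Real.Gamma_pos_of_pos (by positivity)
  unfold deficitVolume
  positivity

/-- With `k = m - 1`, the squared radius `2 / (-g'')` and the factor `√π ^ k` of the ball volume
combine into `(2π / (-g'')) ^ (k / 2)`. -/
theorem deficitVolume_mul_eq_weibullConst {g p : ℝ → ℝ} {k : ℕ}
    (hneg : iteratedDeriv 2 g (2 * π / (k + 1 : ℕ)) < 0) :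
    deficitVolume g k * ∫ a in (0 : ℝ)..(2 * π), ∏ l ∈ Finset.range (k + 1),
      p (a + 2 * π * l / (k + 1 : ℕ)) = weibullConst (k + 1) g p := by
  unfold deficitVolume weibullConst
  generalize ∫ a in (0 : ℝ)..(2 * π), ∏ l ∈ Finset.range (k + 1),
    p (a + 2 * π * l / (k + 1 : ℕ)) = I
  set D := iteratedDeriv 2 g (2 * π / (k + 1 : ℕ)) with hD
  have hD0 : 0 < -D := neg_pos.2 hneg
  have h1 : ((k + 1 : ℕ) : ℝ) - 1 = k := by push_cast; ring
  have h2 : (((k + 1 : ℕ) : ℝ) + 1) / 2 = k / 2 + 1 := by push_cast; ring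
  have h3 : ∀ x : ℝ, 0 ≤ x → √x ^ k = x ^ ((k : ℝ) / 2) := fun x hx => by
    rw [Real.sqrt_eq_rpow, ← Real.rpow_natCast, ← Real.rpow_mul hx]
    congr 1; ring
  have hG : Real.Gamma (k / 2 + 1 : ℝ) ≠ 0 := (Real.Gamma_pos_of_pos (by positivity)).ne'
  have hs : √((k + 1 : ℕ) : ℝ) ≠ 0 := (Real.sqrt_pos.2 (by positivity)).ne'
  have hp : (-D) ^ ((k : ℝ) / 2) ≠ 0 := (Real.rpow_pos_of_pos hD0 _).ne'
  rw [h1, h2, h3 _ (by positivity), h3 _ Real.pi_pos.le, Real.div_rpow two_pos.le hD0.le,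
    Real.mul_rpow two_pos.le Real.pi_pos.le, show (k + 1 : ℝ) = ((k + 1 : ℕ) : ℝ) by push_cast; rfl]
  field_simp

/-- The asymptotic probability that the kernel of a random tuple is close to its maximum. -/
theorem tendsto_measureReal_sub_arcKernel_div {k : ℕ} (hk : k ≠ 0) {p g : ℝ → ℝ}
    [IsProbabilityMeasure (circleLaw p)] (hp : Continuous p) (hp0 : ∀ x, 0 ≤ p x) {M : ℝ}
    (hM : ∀ x, p x ≤ M) (hper : Function.Periodic p (2 * π))
    (hg : ContinuousOn g (Set.Icc 0 (2 * π))) (hg2 : ContDiffAt ℝ 2 g (2 * π / (k + 1 : ℕ)))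
    (hneg : iteratedDeriv 2 g (2 * π / (k + 1 : ℕ)) < 0) {c : ℝ} (hc : 0 < c)
    (hgc : ∀ d, 2 * π / (k + 1 : ℕ) + d ∈ Set.Icc 0 (2 * π) →
      c * d ^ 2 ≤ tangentGap g (2 * π / (k + 1 : ℕ)) d) :
    Tendsto (fun e => (Measure.pi fun _ : Fin (k + 1) => circleLaw p).real
        {u | ((k + 1 : ℕ) : ℝ) * g (2 * π / (k + 1 : ℕ)) - arcKernel g u ≤ e ^ 2} / e ^ k)
      (𝓝[>] 0) (𝓝 (k.factorial * weibullConst (k + 1) g p)) := by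
  have h := tendsto_lintegral_localIntegral hp hp0 hM hg hg2 hneg hc hgc hk
  have hlim : ∫⁻ a in Set.Ico 0 (2 * π), ENNReal.ofReal (p a) *
        (ENNReal.ofReal (∏ j : Fin k, p (a + 2 * π * (j + 1) / (k + 1 : ℕ))) *
          volume {z : Fin k → ℝ | deficitForm g z ≤ 1}) =
      ENNReal.ofReal (weibullConst (k + 1) g p) := by
    have hV := deficitVolume_nonneg g k
    -- The density `p a` of the first point is the factor `l = 0` of the product.
    have hint : ∀ a, ENNReal.ofReal (p a) *
        (ENNReal.ofReal (∏ j : Fin k, p (a + 2 * π * (j + 1) / (k + 1 : ℕ))) *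
          volume {z : Fin k → ℝ | deficitForm g z ≤ 1}) =
        ENNReal.ofReal (deficitVolume g k *
          ∏ l ∈ Finset.range (k + 1), p (a + 2 * π * l / (k + 1 : ℕ))) := by
      intro a
      rw [volume_deficitForm_le hk hneg, ← ENNReal.ofReal_mul
        (Finset.prod_nonneg fun _ _ => hp0 _), ← ENNReal.ofReal_mul (hp0 a),
        Finset.prod_range_succ', Finset.prod_range]
      congr 1
      push_cast
      simp only [mul_zero, zero_div, add_zero]
      unfold deficitVolume
      push_cast
      ring
    have hcont : Continuous fun a => deficitVolume g k *
        ∏ l ∈ Finset.range (k + 1), p (a + 2 * π * l / (k + 1 : ℕ)) := by fun_prop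
    simp_rw [hint]
    rw [restrict_Ico_eq_restrict_Ioc, ← ofReal_integral_eq_lintegral_ofReal
      (hcont.integrableOn_Icc.mono_set Set.Ioc_subset_Icc_self)
      (ae_of_all _ fun a => mul_nonneg hV (Finset.prod_nonneg fun _ _ => hp0 _)),
      ← intervalIntegral.integral_of_le Real.two_pi_pos.le, intervalIntegral.integral_const_mul,
      deficitVolume_mul_eq_weibullConst hneg]
  have hnn : 0 ≤ weibullConst (k + 1) g p := by
    rw [← deficitVolume_mul_eq_weibullConst hneg]
    exact mul_nonneg (deficitVolume_nonneg g k) (intervalIntegral.integral_nonneg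
      Real.two_pi_pos.le fun _ _ => Finset.prod_nonneg fun _ _ => hp0 _)
  rw [hlim] at h
  have h2 := ((ENNReal.tendsto_toReal ENNReal.ofReal_ne_top).comp h).const_mul (k.factorial : ℝ)
  rw [ENNReal.toReal_ofReal hnn] at h2
  refine h2.congr' ?_
  filter_upwards [self_mem_nhdsWithin] with e he
  have he : 0 < e := he
  rw [measureReal_def, pi_circleLaw_eq_localIntegral hp hp0 hg hper he, ENNReal.toReal_mul,
    ENNReal.toReal_ofReal (by positivity)]
  simp only [Function.comp]
  field_simp

/-! ### Passage to the limit -/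

theorem exists_forall_le_of_periodic {p : ℝ → ℝ} (hp : Continuous p)
    (hper : Function.Periodic p (2 * π)) : ∃ M, ∀ x, p x ≤ M := by
  obtain ⟨M, hM⟩ := (hper.compact_of_continuous Real.two_pi_pos.ne' hp).bddAbove
  exact ⟨M, fun x => hM ⟨x, rfl⟩⟩

theorem le_uMax_iff {X : Type*} {m n : ℕ} (hmn : m ≤ n) (f : (Fin m → X) → ℝ) (x : ℕ → X) (s : ℝ) :
    s ≤ uMax f x n ↔ ∃ a : Fin m ↪o Fin n, s ≤ f fun j => x (a j) := by
  have : Nonempty (Fin m ↪o Fin n) := ⟨Fin.castLEOrderEmb hmn⟩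
  constructor
  · intro h
    obtain ⟨a, ha⟩ := exists_eq_ciSup_of_finite (f := fun a : Fin m ↪o Fin n => f fun j => x (a j))
    exact ⟨a, h.trans_eq ha.symm⟩
  · rintro ⟨a, ha⟩
    exact ha.trans (le_ciSup (f := fun a : Fin m ↪o Fin n => f fun j => x (a j))
      (Set.finite_range _).bddAbove a)

/-- The scale at which the deficit of the best of `n` random points is observed. -/
def deficitScale (t : ℝ) (k n : ℕ) : ℝ := √t * (n : ℝ) ^ (-(((k : ℝ) + 1) / k))

theorem tendsto_deficitScale {t : ℝ} (ht : 0 < t) {k : ℕ} (hk : k ≠ 0) :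
    Tendsto (deficitScale t k) atTop (𝓝[>] 0) := by
  have hk' : (0 : ℝ) < k := by exact_mod_cast Nat.pos_of_ne_zero hk
  refine tendsto_nhdsWithin_iff.2 ⟨?_, ?_⟩
  · have h := ((tendsto_rpow_neg_atTop (y := ((k : ℝ) + 1) / k) (by positivity)).comp
      tendsto_natCast_atTop_atTop).const_mul √t
    rw [mul_zero] at h
    exact h
  · filter_upwards [eventually_gt_atTop 0] with n hn
    have hn' : (0 : ℝ) < n := by exact_mod_cast hn
    exact mul_pos (Real.sqrt_pos.2 ht) (Real.rpow_pos_of_pos hn' _)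

theorem deficitScale_pow {t : ℝ} {k n : ℕ} (hk : k ≠ 0) :
    deficitScale t k n ^ k = √t ^ k / (n : ℝ) ^ (k + 1) := by
  have hk' : (k : ℝ) ≠ 0 := by exact_mod_cast hk
  have hn : (0 : ℝ) ≤ n := Nat.cast_nonneg n
  rw [deficitScale, mul_pow, ← Real.rpow_natCast ((n : ℝ) ^ _), ← Real.rpow_mul hn, neg_mul,
    div_mul_cancel₀ _ hk', Real.rpow_neg hn, div_eq_mul_inv]
  congr 2
  exact_mod_cast Real.rpow_natCast (n : ℝ) (k + 1)

/-- The exponent of `n` is `r - (r - 1)(k + 1)/k = -(r - (k + 1))/k`, negative exactly when `r > k +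
1`. -/
theorem tendsto_pow_mul_deficitScale_pow {t : ℝ} {k : ℕ} (hk : k ≠ 0) {r : ℕ} (hr : k + 1 < r) :
    Tendsto (fun n : ℕ => (n : ℝ) ^ r * deficitScale t k n ^ (r - 1)) atTop (𝓝 0) := by
  have hk' : (0 : ℝ) < k := by exact_mod_cast Nat.pos_of_ne_zero hk
  have hr' : (k : ℝ) + 1 < r := by exact_mod_cast hr
  have h := ((tendsto_rpow_neg_atTop (y := ((r : ℝ) - (k + 1)) / k)
    (div_pos (by linarith) hk')).comp tendsto_natCast_atTop_atTop).const_mul (√t ^ (r - 1))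
  rw [mul_zero] at h
  refine h.congr' ?_
  filter_upwards [eventually_gt_atTop 0] with n hn
  have hn' : (0 : ℝ) < n := by exact_mod_cast hn
  have hr1 : ((r - 1 : ℕ) : ℝ) = r - 1 := by
    rw [Nat.cast_sub (by omega), Nat.cast_one]
  rw [deficitScale, mul_pow, ← Real.rpow_natCast ((n : ℝ) ^ _), ← Real.rpow_mul hn'.le, hr1,
    mul_left_comm, ← Real.rpow_natCast (n : ℝ) r, ← Real.rpow_add hn']
  simp only [Function.comp]
  congr 2
  field_simp
  ring

/-- Since `choose n (k + 1) ~ n^(k+1) / (k + 1)!`, the powers of `n` cancel and `k! / (k + 1)!`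
leaves the factor `1 / (k + 1)`. -/
theorem tendsto_choose_mul {t : ℝ} (ht : 0 < t) {k : ℕ} (hk : k ≠ 0) {P : ℝ → ℝ} {L : ℝ}
    (hP : Tendsto (fun e => P e / e ^ k) (𝓝[>] 0) (𝓝 (k.factorial * L))) :
    Tendsto (fun n : ℕ => (n.choose (k + 1) : ℝ) * P (deficitScale t k n)) atTop
      (𝓝 (√t ^ k * L / (k + 1))) := by
  have h1 := hP.comp (tendsto_deficitScale ht hk)
  have h2 : Tendsto (fun n : ℕ => (n.choose (k + 1) : ℝ) / (n ^ (k + 1) / (k + 1).factorial)) atTop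
      (𝓝 1) := by
    refine (Asymptotics.isEquivalent_iff_tendsto_one ?_).1 (isEquivalent_choose (k + 1))
    filter_upwards [eventually_gt_atTop 0] with n hn
    have hn' : (0 : ℝ) < n := by exact_mod_cast hn
    positivity
  have h3 := (h1.mul h2).mul_const (√t ^ k / (k + 1).factorial)
  have hfac : ((k + 1).factorial : ℝ) = (k + 1) * k.factorial := by
    exact_mod_cast Nat.factorial_succ k
  have hk0 : (k.factorial : ℝ) ≠ 0 := by positivity
  have heq : k.factorial * L * 1 * (√t ^ k / (k + 1).factorial) = √t ^ k * L / (k + 1) := by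
    rw [hfac]
    field_simp
  rw [heq] at h3
  refine h3.congr' ?_
  filter_upwards [eventually_gt_atTop 0] with n hn
  have hn' : (0 : ℝ) < n := by exact_mod_cast hn
  have ht' : √t ≠ 0 := (Real.sqrt_pos.2 ht).ne'
  simp only [Function.comp, deficitScale_pow hk]
  field_simp

/-- At this scale `P` is of order at most `n^(-(k+1))`, so its square beats every power of `n` below
`2(k + 1)`. -/
theorem tendsto_pow_mul_sq {t : ℝ} (ht : 0 < t) {k : ℕ} (hk : k ≠ 0) {P : ℝ → ℝ} {L : ℝ}
    (hP : Tendsto (fun e => P e / e ^ k) (𝓝[>] 0) (𝓝 L)) {r : ℕ} (hr : r < 2 * (k + 1)) :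
    Tendsto (fun n : ℕ => (n : ℝ) ^ r * P (deficitScale t k n) ^ 2) atTop (𝓝 0) := by
  have h1 := hP.comp (tendsto_deficitScale ht hk)
  have h2 : Tendsto (fun n : ℕ => ((n : ℝ) ^ (2 * (k + 1) - r))⁻¹) atTop (𝓝 0) :=
    tendsto_inv_atTop_zero.comp ((tendsto_pow_atTop (by omega)).comp tendsto_natCast_atTop_atTop)
  have h3 := ((h1.pow 2).mul h2).mul_const ((√t ^ k) ^ 2)
  rw [mul_zero, zero_mul] at h3
  refine h3.congr' ?_
  filter_upwards [eventually_gt_atTop 0] with n hn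
  have hn' : (n : ℝ) ≠ 0 := by exact_mod_cast hn.ne'
  have ht' : √t ≠ 0 := (Real.sqrt_pos.2 ht).ne'
  have hpow : ((n : ℝ) ^ (k + 1)) ^ 2 = (n : ℝ) ^ (2 * (k + 1) - r) * (n : ℝ) ^ r := by
    rw [← pow_mul, ← pow_add]; congr 1; omega
  simp only [Function.comp, deficitScale_pow hk]
  rw [div_pow, div_pow, hpow]
  field_simp

theorem rpow_mul_le_iff {t x : ℝ} (ht : 0 < t) {k n : ℕ} (hk : k ≠ 0) (hn : 0 < n) :
    (n : ℝ) ^ (2 * ((k + 1 : ℕ) : ℝ) / (((k + 1 : ℕ) : ℝ) - 1)) * x ≤ t ↔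
      x ≤ deficitScale t k n ^ 2 := by
  have hn' : (0 : ℝ) < n := by exact_mod_cast hn
  have hk' : (k : ℝ) ≠ 0 := by exact_mod_cast hk
  have h1 : deficitScale t k n ^ 2 =
      t / (n : ℝ) ^ (2 * ((k + 1 : ℕ) : ℝ) / (((k + 1 : ℕ) : ℝ) - 1)) := by
    rw [deficitScale, mul_pow, Real.sq_sqrt ht.le, ← Real.rpow_natCast ((n : ℝ) ^ _),
      ← Real.rpow_mul hn'.le, div_eq_mul_inv t, ← Real.rpow_neg hn'.le]
    congr 2
    push_cast
    rw [add_sub_cancel_right]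
    ring
  rw [h1, le_div_iff₀' (Real.rpow_pos_of_pos hn' _)]

theorem tendsto_measureReal_uMax_arcKernel
    {Ω : Type*} [MeasurableSpace Ω] (μ : Measure Ω) [IsProbabilityMeasure μ] {k : ℕ} (hk : k ≠ 0)
    {p : ℝ → ℝ} (hp : Continuous p) (hp0 : ∀ x, 0 ≤ p x) (hper : Function.Periodic p (2 * π))
    {U : ℕ → Ω → Circle} (hU : ∀ i, Measurable (U i)) (hind : iIndepFun U μ)
    (hlaw : ∀ i, μ.map (U i) = circleLaw p)
    {g : ℝ → ℝ} (hg : ContinuousOn g (Set.Icc 0 (2 * π)))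
    (hconc : StrictConcaveOn ℝ (Set.Icc 0 (2 * π)) g)
    (hg2 : ContDiffAt ℝ 2 g (2 * π / (k + 1 : ℕ)))
    (hnd : iteratedDeriv 2 g (2 * π / (k + 1 : ℕ)) ≠ 0) {t : ℝ} (ht : 0 < t) :
    Tendsto (fun n : ℕ => μ.real {ω | (n : ℝ) ^ (2 * ((k + 1 : ℕ) : ℝ) / (((k + 1 : ℕ) : ℝ) - 1)) *
        (((k + 1 : ℕ) : ℝ) * g (2 * π / (k + 1 : ℕ)) -
          uMax (arcKernel (m := k + 1) g) (fun i => U i ω) n) ≤ t}) atTop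
      (𝓝 (1 - Real.exp (-(√t ^ k * weibullConst (k + 1) g p / (k + 1))))) := by
  have hprob : IsProbabilityMeasure (circleLaw p) := isProbabilityMeasure_of_map_eq hU hlaw
  obtain ⟨M, hM⟩ := exists_forall_le_of_periodic hp hper
  have hM0 : 0 ≤ M := (hp0 0).trans (hM 0)
  have hm1 : (1 : ℝ) < (k + 1 : ℕ) := by
    exact_mod_cast Nat.succ_lt_succ (Nat.pos_of_ne_zero hk)
  have hnhds : Set.Icc 0 (2 * π) ∈ 𝓝 (2 * π / (k + 1 : ℕ)) :=
    Icc_mem_nhds (by have := Real.pi_pos; positivity) (div_lt_self Real.two_pi_pos hm1)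
  have hneg := hconc.iteratedDeriv_two_neg hnhds hg2 hnd
  obtain ⟨c, hc, hgc⟩ := hconc.exists_mul_sq_le_tangentGap isCompact_Icc hg hnhds hg2 hnd
  set G : ℝ → Set (Fin (k + 1) → Circle) := fun e =>
    {u | ((k + 1 : ℕ) : ℝ) * g (2 * π / (k + 1 : ℕ)) - arcKernel g u ≤ e ^ 2} with hG
  set P : ℝ → ℝ := fun e => (Measure.pi fun _ : Fin (k + 1) => circleLaw p).real (G e) with hP
  have hPlim : Tendsto (fun e => P e / e ^ k) (𝓝[>] 0)
      (𝓝 (k.factorial * weibullConst (k + 1) g p)) :=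
    tendsto_measureReal_sub_arcKernel_div hk hp hp0 hM hper hg hg2 hneg hc hgc
  have hGm : ∀ e, MeasurableSet (G e) := fun e => by
    rw [hG]
    dsimp only
    rw [setOf_sub_arcKernel_le]
    exact measurable_centralAngle_tuple (measurableSet_angleSet hg (k + 1) (e ^ 2))
  -- `C * e` bounds the probability that the `m`-th power of a random point lies within `2 m² e /
  -- √c` of a given one. The deviation `e / √c` comes from `abs_sortedGap_sub_le`, and `2 m²` from
  -- `dist_pow_pow_le`.
  set C : ℝ := M * (((k + 1 : ℕ) + 2) * (π / (k + 1 : ℕ))) * (2 * (k + 1 : ℕ) ^ 2 / √c) with hC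
  have hC0 : 0 ≤ C := by have := Real.pi_pos; positivity
  -- the error of the Poisson approximation
  set err : ℕ → ℝ := fun n =>
    (∑ r ∈ Finset.range (2 * (k + 1)), 4 ^ r * (n : ℝ) ^ r) * P (deficitScale t k n) ^ 2 +
      ∑ r ∈ Finset.Ioo (k + 1) (2 * (k + 1)),
        4 ^ r * (n : ℝ) ^ r * (C * deficitScale t k n) ^ (r - 1) with herr
  have herr0 : Tendsto err atTop (𝓝 0) := by
    have h1 : Tendsto (fun n : ℕ => ∑ r ∈ Finset.range (2 * (k + 1)),
        4 ^ r * ((n : ℝ) ^ r * P (deficitScale t k n) ^ 2)) atTop (𝓝 0) := by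
      rw [← Finset.sum_const_zero (s := Finset.range (2 * (k + 1)))]
      refine tendsto_finsetSum _ fun r hr => ?_
      simpa using (tendsto_pow_mul_sq ht hk hPlim (Finset.mem_range.1 hr)).const_mul ((4 : ℝ) ^ r)
    have h2 : Tendsto (fun n : ℕ => ∑ r ∈ Finset.Ioo (k + 1) (2 * (k + 1)),
        4 ^ r * C ^ (r - 1) * ((n : ℝ) ^ r * deficitScale t k n ^ (r - 1))) atTop (𝓝 0) := by
      rw [← Finset.sum_const_zero (s := Finset.Ioo (k + 1) (2 * (k + 1)))]
      refine tendsto_finsetSum _ fun r hr => ?_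
      simpa using (tendsto_pow_mul_deficitScale_pow (t := t) hk
        (Finset.mem_Ioo.1 hr).1).const_mul ((4 : ℝ) ^ r * C ^ (r - 1))
    have h3 := h1.add h2
    rw [add_zero] at h3
    refine h3.congr fun n => ?_
    rw [herr]
    dsimp only
    rw [Finset.sum_mul]
    congr 1
    · exact Finset.sum_congr rfl fun r _ => by ring
    · exact Finset.sum_congr rfl fun r _ => by rw [mul_pow C]; ring
  -- the Poisson approximation
  have hpoisson : ∀ n : ℕ, 0 < n →
      |μ.real {ω | ∀ a : Fin (k + 1) ↪o Fin n, (fun j => U (a j) ω) ∉ G (deficitScale t k n)} -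
        Real.exp (-(n.choose (k + 1) * P (deficitScale t k n)))| ≤ err n := by
    intro n hn
    set e := deficitScale t k n with he
    have he0 : 0 ≤ e := by rw [he, deficitScale]; positivity
    refine abs_measureReal_forall_notMem_sub_exp_le (U := fun i : Fin n => U i)
      (R := {z | dist (z.2 ^ (k + 1)) (z.1 ^ (k + 1)) ≤ 2 * (k + 1 : ℕ) ^ 2 * (e / √c)})
      (Nat.succ_pos k) (fun i => hU i) (hind.precomp Fin.val_injective) (fun i => hlaw i)
      (hGm e) ?_ (by positivity) ?_ ?_
    · exact (isClosed_le (by fun_prop) continuous_const).measurableSet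
    · intro u
      refine (circleLaw_dist_pow_le hM hM0 (m := k + 1) (u ^ (k + 1)) _).trans (le_of_eq ?_)
      congr 1
      rw [hC]
      ring
    · intro u hu i j
      have hu' : (fun j => centralAngle (u 0) (u j)) ∈ angleSet g (k + 1) (e ^ 2) := by
        have : u ∈ {u : Fin (k + 1) → Circle |
            ((k + 1 : ℕ) : ℝ) * g (2 * π / (k + 1 : ℕ)) - arcKernel g u ≤ e ^ 2} := hu
        rwa [setOf_sub_arcKernel_le] at this
      exact dist_pow_pow_le (fun i => abs_sortedGap_sub_le hc hgc he0 hu'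
        (centralAngle_self _) i) j i
  have hlam := tendsto_choose_mul ht hk hPlim
  have hexp : Tendsto (fun n : ℕ => Real.exp (-(n.choose (k + 1) * P (deficitScale t k n)))) atTop
      (𝓝 (Real.exp (-(√t ^ k * weibullConst (k + 1) g p / (k + 1))))) :=
    (Real.continuous_exp.tendsto _).comp hlam.neg
  have hdiff : Tendsto (fun n : ℕ =>
      μ.real {ω | ∀ a : Fin (k + 1) ↪o Fin n, (fun j => U (a j) ω) ∉ G (deficitScale t k n)} -
        Real.exp (-(n.choose (k + 1) * P (deficitScale t k n)))) atTop (𝓝 0) := by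
    refine squeeze_zero_norm' ?_ herr0
    filter_upwards [eventually_gt_atTop 0] with n hn
    exact hpoisson n hn
  have hnone := (hdiff.add hexp).const_sub 1
  rw [zero_add] at hnone
  refine hnone.congr' ?_
  filter_upwards [eventually_ge_atTop (k + 1)] with n hn
  have hn0 : 0 < n := by omega
  -- A finite supremum is attained, so it reaches a level exactly when some tuple does.
  have hset : {ω | (n : ℝ) ^ (2 * ((k + 1 : ℕ) : ℝ) / (((k + 1 : ℕ) : ℝ) - 1)) *
      (((k + 1 : ℕ) : ℝ) * g (2 * π / (k + 1 : ℕ)) -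
        uMax (arcKernel (m := k + 1) g) (fun i => U i ω) n) ≤ t} =
      {ω | ∀ a : Fin (k + 1) ↪o Fin n, (fun j => U (a j) ω) ∉ G (deficitScale t k n)}ᶜ := by
    ext ω
    rw [Set.mem_ofPred_eq, rpow_mul_le_iff ht hk hn0, sub_le_comm, le_uMax_iff hn]
    simp only [hG, Set.mem_compl_iff, Set.mem_ofPred_eq, not_forall, not_not, sub_le_comm]
  have hmeas : MeasurableSet
      {ω | ∀ a : Fin (k + 1) ↪o Fin n, (fun j => U (a j) ω) ∉ G (deficitScale t k n)} := by
    rw [Set.ofPred_forall]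
    refine MeasurableSet.iInter fun a => ?_
    exact (measurable_pi_lambda _ fun j => hU (a j)) (hGm _).compl
  rw [hset, measureReal_compl hmeas, probReal_univ]
  ring

end

theorem corollary5p1
    {Ω : Type*} [MeasurableSpace Ω] (μ : Measure Ω) [IsProbabilityMeasure μ]
    (m : ℕ) [NeZero m] (hm : 2 ≤ m)
    -- the common density of the points
    (p : ℝ → ℝ) (hp_cont : Continuous p) (hp_nonneg : ∀ x, 0 ≤ p x)
    (hp_per : Function.Periodic p (2 * π))
    (hp_int : ∫ x in (0 : ℝ)..(2 * π), p x = 1)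
    (hp_pos : 0 < ∫ x in (0 : ℝ)..(2 * π), ∏ l ∈ Finset.range m, p (x + 2 * π * l / m))
    -- the random points
    (U : ℕ → Ω → Circle) (hU_meas : ∀ i, Measurable (U i)) (hU_indep : iIndepFun U μ)
    (hU_law : ∀ i, μ.map (U i) = circleLaw p)
    -- the function generating the kernel
    (g : ℝ → ℝ) (hg_cont : ContinuousOn g (Set.Icc 0 (2 * π)))
    (hg_conc : StrictConcaveOn ℝ (Set.Icc 0 (2 * π)) g)
    (hg_smooth : ContDiffAt ℝ 3 g (2 * π / m))
    (hg_nondeg : iteratedDeriv 2 g (2 * π / m) ≠ 0)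
    (t : ℝ) (ht : 0 < t) :
    Tendsto
      (fun n : ℕ => μ.real {ω | (n : ℝ) ^ (2 * (m : ℝ) / ((m : ℝ) - 1)) *
        (m * g (2 * π / m) - uMax (arcKernel (m := m) g) (fun i => U i ω) n) ≤ t})
      atTop
      (𝓝 (1 - Real.exp (-(t ^ (((m : ℝ) - 1) / 2) * weibullConst m g p / m)))) := by
  -- The angles other than the first give `k = m - 1` free coordinates, the dimension of the
  -- ellipsoid.
  obtain ⟨k, rfl⟩ : ∃ k, m = k + 1 := ⟨m - 1, by omega⟩
  have h := tendsto_measureReal_uMax_arcKernel μ (k := k) (by omega) hp_cont hp_nonneg hp_per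
    hU_meas hU_indep hU_law hg_cont hg_conc (hg_smooth.of_le (by norm_num)) hg_nondeg ht
  have hpow : √t ^ k = t ^ ((((k + 1 : ℕ) : ℝ) - 1) / 2) := by
    rw [Real.sqrt_eq_rpow, ← Real.rpow_natCast, ← Real.rpow_mul ht.le]
    congr 1
    push_cast
    ring
  rw [hpow] at h
  convert h using 5
  push_cast
  ring
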